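/- All Hilbert spaces are finite-dimensional and complex, $\log$ is the natural logarithm (any other base greater than $1$ rescales all terms below by the same factor), and functions of Hermitian operators are defined spectrally. Set $H(\omega)=-\mathrm{tr}(\omega\log\omega)$ with $0\log 0=0$, and for a tripartite state $\rho_{ABC}$ with marginals $\rho_{AB},\rho_{BC},\rho_B$ set $$I(A:C|B)_\rho = H(\rho_{AB})+H(\rho_{BC})-H(\rho_{ABC})-H(\rho_B).$$ For non-negative operators, let $D(\rho\|\sigma)=\mathrm{tr}(\rho(\log\rho-\log\sigma))$ if $\mathrm{supp}(\rho)\subseteq\mathrm{supp}(\sigma)$ and $+\infty$ otherwise. Let $F(\rho,\sigma)=\|\sqrt\rho\sqrt\sigma\|_1$, and let the measured relative entropy be $$D_{\mathbb M}(\rho\|\sigma)=\sup D\big(\mathcal M(\rho)\,\big\|\,\mathcal M(\sigma)\big),\qquad \mathcal M(\omega)=\sum_x \mathrm{tr}(\omega M_x)\,|x\rangle\langle x|,$$ where the supremum runs over all finite projective measurements $\{M_x\}$ (orthogonal projections with $\sum_x M_x=\mathrm{id}$) and $\{|x\rangle\}$ is a finite orthonormal family. Both $D$ and $D_{\mathbb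 M}$ take values in $[-\infty,+\infty]$, and $-2\log 0=+\infty$. For a Hermitian operator $\tau$ with distinct eigenvalues $\lambda_1,\dots,\lambda_d$ and eigenprojections $P_1,\dots,P_d$, and for $\vartheta\in[0,2\pi]^{d}$, let $U_\tau^\vartheta=\sum_k e^{i\vartheta_k}P_k$. For a non-negative operator $\sigma$ and a trace-preserving completely positive map $\mathcal N$ with Hilbert--Schmidt adjoint $\mathcal N^\dagger$, the rotated Petz recovery maps are $$\mathcal T^{\varphi,\vartheta}_{\sigma,\mathcal N}(X)=U_\sigma^\vartheta\,\sigma^{1/2}\,\mathcal N^\dagger\!\Big(\mathcal N(\sigma)^{-1/2}\,U^\varphi_{\mathcal N(\sigma)}\,X\,U^{\varphi\,\dagger}_{\mathcal N(\sigma)}\,\mathcal N(\sigma)^{-1/2}\Big)\sigma^{1/2}\,U_\sigma^{\vartheta\,\dagger},$$ where all components of $\varphi$ and $\vartheta$ lie in $[0,2\pi]$ and $\mathcal N(\sigma)^{-1/2}$ is the inverse taken on the support of $\mathcal N(\sigma)$ and $0$ on its kernel. Let $\mathrm T_{\sigma,\mathcal N}$ be the convex hull of the set of all these maps. **Corollary.**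 For every density operator $\rho_{ABC}$ on $A\otimes B\otimes C$ there exists a map $\mathcal R_{B\to BC}\in\mathrm T_{\rho_{BC},\mathrm{tr}_C}$ such that $$I(A:C|B)_\rho\ \ge\ D_{\mathbb M}\big(\rho_{ABC}\,\big\|\,(\mathrm{id}_A\otimes\mathcal R_{B\to BC})(\rho_{AB})\big)\ \ge\ -2\log F\big(\rho_{ABC},\,(\mathrm{id}_A\otimes\mathcal R_{B\to BC})(\rho_{AB})\big).$$ -/

import Mathlib

noncomputable section

namespace QuantumRecovery

/-! Operators on a finite-dimensional Hilbert space with an orthonormal basis indexed by `m` are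
matrices `Matrix m m ℂ`; the tensor product of two spaces is indexed by the product of the index
types. Functions of Hermitian matrices are given by the functional calculus `cfc`. All logarithms
are natural. -/

section

variable {m n k : Type*} [Fintype m] [DecidableEq m] [Fintype n] [DecidableEq n]
  [Fintype k] [DecidableEq k]

open scoped ComplexOrder in
/-- Density operators: positive semidefinite of trace one. -/
def IsDensity (ρ : Matrix m m ℂ) : Prop := ρ.PosSemidef ∧ ρ.trace = 1

/-- The partial trace over the second factor. -/
def traceRight (m n : Type*) [Fintype n] : Matrix (m × n) (m × n) ℂ →ₗ[ℂ] Matrix m m ℂ where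
  toFun X := Matrix.of fun i j => ∑ x, X (i, x) (j, x)
  map_add' X Y := by ext i j; simp [Finset.sum_add_distrib]
  map_smul' c X := by ext i j; simp [Finset.mul_sum]

/-- The partial trace over the first factor. -/
def traceLeft (m n : Type*) [Fintype m] : Matrix (m × n) (m × n) ℂ →ₗ[ℂ] Matrix n n ℂ where
  toFun X := Matrix.of fun i j => ∑ x, X (x, i) (x, j)
  map_add' X Y := by ext i j; simp [Finset.sum_add_distrib]
  map_smul' c X := by ext i j; simp [Finset.mul_sum]

/-- The map `id_A ⊗ R` for a linear map `R` between matrix spaces: it applies `R` to each of the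
blocks `X_{a a'}` of `X = ∑ |a⟩⟨a'| ⊗ X_{a a'}`. -/
def idTensor (A : Type*) (R : Matrix m m ℂ →ₗ[ℂ] Matrix n n ℂ) :
    Matrix (A × m) (A × m) ℂ →ₗ[ℂ] Matrix (A × n) (A × n) ℂ where
  toFun X := Matrix.of fun i j => R (Matrix.of fun x y => X (i.1, x) (j.1, y)) i.2 j.2
  map_add' X Y := by
    ext i j
    exact congrFun₂ (R.map_add (Matrix.of fun x y => X (i.1, x) (j.1, y))
      (Matrix.of fun x y => Y (i.1, x) (j.1, y))) i.2 j.2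
  map_smul' c X := by
    ext i j
    exact congrFun₂ (R.map_smul c (Matrix.of fun x y => X (i.1, x) (j.1, y))) i.2 j.2

/-- The adjoint `N†` of a linear map `N` with respect to the Hilbert–Schmidt inner product
`⟨X, Y⟩ = tr (X† Y)`; see `trace_hsAdjoint`. -/
def hsAdjoint (N : Matrix m m ℂ →ₗ[ℂ] Matrix n n ℂ) : Matrix n n ℂ →ₗ[ℂ] Matrix m m ℂ where
  toFun Y := Matrix.of fun i j => ((N (Matrix.single i j 1)).conjTranspose * Y).trace
  map_add' X Y := by ext i j; simp [Matrix.mul_add]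
  map_smul' c X := by ext i j; simp

/-- The defining property of the adjoint: `⟨N X, Y⟩ = ⟨X, N† Y⟩`. -/
theorem trace_hsAdjoint (N : Matrix m m ℂ →ₗ[ℂ] Matrix n n ℂ) (X : Matrix m m ℂ)
    (Y : Matrix n n ℂ) :
    ((N X).conjTranspose * Y).trace = (X.conjTranspose * hsAdjoint N Y).trace := by
  have h : N X = ∑ i, ∑ j, X i j • N (Matrix.single i j 1) := by
    conv_lhs => rw [Matrix.matrix_eq_sum_single X]
    simp only [map_sum]
    refine Finset.sum_congr rfl fun i _ => Finset.sum_congr rfl fun j _ => ?_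
    rw [← map_smul, Matrix.smul_single, smul_eq_mul, mul_one]
  rw [h]
  simp only [Matrix.conjTranspose_sum, Matrix.conjTranspose_smul, Finset.sum_mul,
    Matrix.smul_mul, Matrix.trace_sum, Matrix.trace_smul, smul_eq_mul]
  rw [Finset.sum_comm]
  simp [Matrix.trace, Matrix.mul_apply, hsAdjoint]

/-- The von Neumann entropy `H(ρ) = -tr (ρ log ρ)`. -/
def entropy (ρ : Matrix m m ℂ) : ℝ := -(ρ * cfc Real.log ρ).trace.re

/-- The conditional mutual information
`I(A : C | B) = H(AB) + H(BC) - H(ABC) - H(B)` of `ρ_ABC`. -/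
def condMutualInfo {A B C : Type*} [Fintype A] [DecidableEq A] [Fintype B] [DecidableEq B]
    [Fintype C] [DecidableEq C] (ρ : Matrix (A × B × C) (A × B × C) ℂ) : ℝ :=
  entropy (idTensor A (traceRight B C) ρ) + entropy (traceLeft A (B × C) ρ)
    - entropy ρ - entropy (traceRight B C (traceLeft A (B × C) ρ))

open Classical in
/-- The relative entropy `D(ρ ‖ σ)` of positive semidefinite matrices: `tr (ρ (log ρ - log σ))` if
the support (the range) of `ρ` is contained in that of `σ`, and `+∞` otherwise. Here `log` acts as
`0` on the kernel, which implements `0 log 0 = 0`. -/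
def relEntropy (ρ σ : Matrix m m ℂ) : EReal :=
  if LinearMap.range ρ.mulVecLin ≤ LinearMap.range σ.mulVecLin then
    (((ρ * (cfc Real.log ρ - cfc Real.log σ)).trace.re : ℝ) : EReal)
  else ⊤

/-- Projective measurements: finite families of orthogonal projections that sum to the identity. -/
def IsProjectiveMeasurement {r : ℕ} (M : Fin r → Matrix m m ℂ) : Prop :=
  (∀ x, (M x).IsHermitian ∧ M x * M x = M x) ∧ ∑ x, M x = 1

/-- The measured state `∑ x, tr (ρ M_x) |x⟩⟨x|`. -/
def measure {r : ℕ} (M : Fin r → Matrix m m ℂ) (ρ : Matrix m m ℂ) : Matrix (Fin r) (Fin r) ℂ :=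
  Matrix.diagonal fun x => (ρ * M x).trace

/-- The measured relative entropy: the supremum of `D(M(ρ) ‖ M(σ))` over all projective
measurements `M`. -/
def measuredRelEntropy (ρ σ : Matrix m m ℂ) : EReal :=
  ⨆ (r : ℕ) (M : Fin r → Matrix m m ℂ) (_ : IsProjectiveMeasurement M),
    relEntropy (measure M ρ) (measure M σ)

/-- The trace norm `‖X‖₁ = tr √(X† X)`. -/
def traceNorm (X : Matrix m m ℂ) : ℝ := (cfc Real.sqrt (X.conjTranspose * X)).trace.re

/-- The fidelity `F(ρ, σ) = ‖√ρ √σ‖₁`. -/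
def fidelity (ρ σ : Matrix m m ℂ) : ℝ := traceNorm (cfc Real.sqrt ρ * cfc Real.sqrt σ)

/-- The orthogonal projection onto the eigenspace of the Hermitian matrix `σ` for `μ`. -/
def spectralProj (σ : Matrix m m ℂ) (μ : ℝ) : Matrix m m ℂ :=
  cfc (fun x : ℝ => if x = μ then 1 else 0) σ

/-- The unitary `∑_μ exp (i ϑ_μ) P_μ`, where the sum runs over the distinct eigenvalues `μ` of the
Hermitian matrix `σ` and `P_μ` is the projection onto the eigenspace. Only the values of `ϑ` at the
eigenvalues of `σ` matter. -/
def phaseUnitary (σ : Matrix m m ℂ) (ϑ : ℝ → ℝ) : Matrix m m ℂ :=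
  ∑ μ ∈ (Matrix.finite_real_spectrum (A := σ)).toFinset,
    Complex.exp (Complex.I * (ϑ μ : ℂ)) • spectralProj σ μ

/-- The inverse square root on the support of a positive semidefinite matrix, extended by `0` on
its kernel. -/
def invSqrt (σ : Matrix m m ℂ) : Matrix m m ℂ := cfc (fun x : ℝ => (Real.sqrt x)⁻¹) σ

/-- Conjugation `X ↦ V X V†` as a linear map. -/
def conjMap (V : Matrix m m ℂ) : Matrix m m ℂ →ₗ[ℂ] Matrix m m ℂ where
  toFun X := V * X * V.conjTranspose
  map_add' X Y := by simp [Matrix.mul_add, Matrix.add_mul]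
  map_smul' c X := by simp

/-- The rotated Petz recovery map
`X ↦ U_σ^ϑ σ^{1/2} N†(N(σ)^{-1/2} U_{N(σ)}^φ X U_{N(σ)}^φ† N(σ)^{-1/2}) σ^{1/2} U_σ^ϑ†`. -/
def rotatedPetz (σ : Matrix m m ℂ) (N : Matrix m m ℂ →ₗ[ℂ] Matrix n n ℂ) (φ ϑ : ℝ → ℝ) :
    Matrix n n ℂ →ₗ[ℂ] Matrix m m ℂ :=
  conjMap (phaseUnitary σ ϑ) ∘ₗ conjMap (cfc Real.sqrt σ) ∘ₗ hsAdjoint N ∘ₗ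
    conjMap (invSqrt (N σ)) ∘ₗ conjMap (phaseUnitary (N σ) φ)

/-- The convex hull of the rotated Petz recovery maps, all angles ranging over `[0, 2π]`. -/
def rotatedPetzHull (σ : Matrix m m ℂ) (N : Matrix m m ℂ →ₗ[ℂ] Matrix n n ℂ) :
    Set (Matrix n n ℂ →ₗ[ℂ] Matrix m m ℂ) :=
  convexHull ℝ {T | ∃ φ ϑ : ℝ → ℝ, (∀ x, φ x ∈ Set.Icc 0 (2 * Real.pi)) ∧
    (∀ x, ϑ x ∈ Set.Icc 0 (2 * Real.pi)) ∧ T = rotatedPetz σ N φ ϑ}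

end

end QuantumRecovery

end

open QuantumRecovery

/-! The measured relative entropy satisfies `D_M(ρ‖τ) ≤ sup_ω (tr ρ log ω + 1 - tr ωτ)` over
positive definite `ω`: a projective measurement with test weights `s` corresponds to `ω = ∑ exp (s
x) M_x` (`measuredRelEntropy_le`). It is therefore enough to bound each of these functionals by
`I(A:C|B)`, with one recovery map for all `ω`.

For fixed `ω`, put `X = log ω + log ρ_BC - log ρ_B + log ρ_AB`. The Gibbs principle `tr ρX ≤ tr ρ
log ρ + tr exp X - 1` says exactly that `tr ρ log ω + 1 - tr exp X ≤ I(A:C|B)`. A four-matrix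
Golden–Thompson inequality (`re_trace_exp_add_le`) bounds `tr exp X` by the supremum over `Re z = 1`
of the squared Hilbert–Schmidt norm of `exp (z w/2) exp (z k/2) exp (z b/2) exp (z l/2)`, the four
summands being `w, k, b, l`. The phases of the two outer factors cancel, those of the inner two are
rotations on eigenspaces, and the value is `tr ω R(ρ_AB)` for a rotated Petz map `R`.
Golden–Thompson itself combines Lie–Trotter with the three lines theorem. Kernels of the marginals
are handled by shifting eigenvalues by `ε` and passing to a limit of angles
(`exists_rotatedPetz_le`).

This `R` depends on `ω`. The functional is affine in the recovered state and concave in `ω`, so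
Sion's minimax theorem on the compact convex hull gives a single `R` (`exists_recovery`).

The fidelity bound comes from one good measurement, in the eigenbasis of `Γ = τ^{-1/2} (τ^{1/2} ρ
τ^{1/2})^{1/2} τ^{-1/2}`. There the likelihood ratio is the squared eigenvalue of `Γ` and the
classical fidelity equals the quantum one; concavity of `log` does the rest. -/

noncomputable section

namespace QuantumRecovery

open Matrix Filter Topology

set_option linter.unusedSectionVars false

/-! ### Complex-valued functional calculus of Hermitian matrices, for phases and complex powers. -/

section SpectralMap

variable {m : Type*} [Fintype m] [DecidableEq m] {A : Matrix m m ℂ}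

/-- The complex functional calculus of a Hermitian matrix in its eigenbasis. -/
def spectralMap (hA : A.IsHermitian) (f : ℝ → ℂ) : Matrix m m ℂ :=
  (hA.eigenvectorUnitary : Matrix m m ℂ) * diagonal (fun i => f (hA.eigenvalues i)) *
    star (hA.eigenvectorUnitary : Matrix m m ℂ)

theorem star_eigenvectorUnitary_mul_self (hA : A.IsHermitian) :
    star (hA.eigenvectorUnitary : Matrix m m ℂ) * (hA.eigenvectorUnitary : Matrix m m ℂ) = 1 :=
  Unitary.coe_star_mul_self hA.eigenvectorUnitary

theorem eigenvectorUnitary_mul_star_self (hA : A.IsHermitian) :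
    (hA.eigenvectorUnitary : Matrix m m ℂ) * star (hA.eigenvectorUnitary : Matrix m m ℂ) = 1 :=
  Unitary.coe_mul_star_self hA.eigenvectorUnitary

theorem spectralMap_mul (hA : A.IsHermitian) (f g : ℝ → ℂ) :
    spectralMap hA f * spectralMap hA g = spectralMap hA (fun x => f x * g x) := by
  unfold spectralMap
  calc _ = (hA.eigenvectorUnitary : Matrix m m ℂ) * diagonal (fun i => f (hA.eigenvalues i)) *
        (star (hA.eigenvectorUnitary : Matrix m m ℂ) * (hA.eigenvectorUnitary : Matrix m m ℂ)) *
        diagonal (fun i => g (hA.eigenvalues i)) *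
        star (hA.eigenvectorUnitary : Matrix m m ℂ) := by simp only [Matrix.mul_assoc]
    _ = _ := by
      rw [star_eigenvectorUnitary_mul_self, Matrix.mul_one, Matrix.mul_assoc _ (diagonal _)
        (diagonal _), diagonal_mul_diagonal]

theorem spectralMap_add (hA : A.IsHermitian) (f g : ℝ → ℂ) :
    spectralMap hA f + spectralMap hA g = spectralMap hA (fun x => f x + g x) := by
  unfold spectralMap
  rw [← Matrix.add_mul, ← Matrix.mul_add, diagonal_add]

theorem spectralMap_smul (hA : A.IsHermitian) (c : ℂ) (f : ℝ → ℂ) :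
    c • spectralMap hA f = spectralMap hA (fun x => c * f x) := by
  unfold spectralMap
  rw [← Matrix.smul_mul, ← Matrix.mul_smul, ← diagonal_smul]
  rfl

theorem spectralMap_sum {ι : Type*} (s : Finset ι) (hA : A.IsHermitian) (f : ι → ℝ → ℂ) :
    ∑ i ∈ s, spectralMap hA (f i) = spectralMap hA (fun x => ∑ i ∈ s, f i x) := by
  classical
  induction s using Finset.induction_on with
  | empty =>
    have : (diagonal fun _ : m => (0 : ℂ)) = 0 := diagonal_zero
    simp [spectralMap]
  | insert a s ha ih => simp_rw [Finset.sum_insert ha]; rw [ih, spectralMap_add]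

theorem spectralMap_const_one (hA : A.IsHermitian) : spectralMap hA (fun _ => 1) = 1 := by
  unfold spectralMap
  rw [show (diagonal fun _ : m => (1 : ℂ)) = 1 from diagonal_one, Matrix.mul_one,
    eigenvectorUnitary_mul_star_self]

theorem spectralMap_congr (hA : A.IsHermitian) {f g : ℝ → ℂ}
    (h : ∀ i, f (hA.eigenvalues i) = g (hA.eigenvalues i)) :
    spectralMap hA f = spectralMap hA g := by
  unfold spectralMap
  simp_rw [h]

theorem spectralMap_conjTranspose (hA : A.IsHermitian) (f : ℝ → ℂ) :
    (spectralMap hA f)ᴴ = spectralMap hA (fun x => star (f x)) := by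
  unfold spectralMap
  simp only [conjTranspose_mul, diagonal_conjTranspose, star_eq_conjTranspose,
    conjTranspose_conjTranspose, Matrix.mul_assoc]
  rfl

theorem cfc_eq_spectralMap (hA : A.IsHermitian) (f : ℝ → ℝ) :
    cfc f A = spectralMap hA (fun x => (f x : ℂ)) := by
  rw [hA.cfc_eq f, IsHermitian.cfc, Unitary.conjStarAlgAut_apply]
  rfl

theorem eq_spectralMap_id (hA : A.IsHermitian) : A = spectralMap hA (fun x => (x : ℂ)) := by
  conv_lhs => rw [hA.spectral_theorem, Unitary.conjStarAlgAut_apply]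
  rfl

theorem trace_spectralMap (hA : A.IsHermitian) (f : ℝ → ℂ) :
    (spectralMap hA f).trace = ∑ i, f (hA.eigenvalues i) := by
  unfold spectralMap
  rw [Matrix.mul_assoc, trace_mul_comm, Matrix.mul_assoc, star_eigenvectorUnitary_mul_self,
    Matrix.mul_one, trace_diagonal]

theorem isHermitian_cfc (f : ℝ → ℝ) (A : Matrix m m ℂ) : (cfc f A).IsHermitian :=
  cfc_predicate (p := IsSelfAdjoint) f A

theorem exp_spectralMap (hA : A.IsHermitian) (f : ℝ → ℂ) :
    NormedSpace.exp (spectralMap hA f) = spectralMap hA (fun x => Complex.exp (f x)) := by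
  have hinv : star (hA.eigenvectorUnitary : Matrix m m ℂ)
      = (hA.eigenvectorUnitary : Matrix m m ℂ)⁻¹ :=
    (Matrix.inv_eq_left_inv (star_eigenvectorUnitary_mul_self hA)).symm
  have hu : IsUnit (hA.eigenvectorUnitary : Matrix m m ℂ) :=
    IsUnit.of_mul_eq_one _ (eigenvectorUnitary_mul_star_self hA)
  unfold spectralMap
  rw [hinv, Matrix.exp_conj _ _ hu, Matrix.exp_diagonal]
  congr 3
  ext i
  rw [Pi.coe_exp, Complex.exp_eq_exp_ℂ]

theorem exp_smul_cfc (hA : A.IsHermitian) (z : ℂ) (f : ℝ → ℝ) :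
    NormedSpace.exp (z • cfc f A) = spectralMap hA (fun x => Complex.exp (z * f x)) := by
  rw [cfc_eq_spectralMap hA, spectralMap_smul, exp_spectralMap]

theorem phaseUnitary_eq_spectralMap (hA : A.IsHermitian) (ϑ : ℝ → ℝ) :
    phaseUnitary A ϑ = spectralMap hA (fun x => Complex.exp (Complex.I * ϑ x)) := by
  unfold phaseUnitary spectralProj
  simp_rw [cfc_eq_spectralMap hA, spectralMap_smul]
  rw [spectralMap_sum]
  refine spectralMap_congr hA fun i => ?_
  rw [Finset.sum_eq_single (hA.eigenvalues i)]
  · simp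
  · intro b _ hb
    simp [hb.symm]
  · intro h
    exact absurd ((Set.Finite.mem_toFinset _).2 (hA.eigenvalues_mem_spectrum_real i)) h

theorem tendsto_spectralMap {ι : Type*} {l : Filter ι} (hA : A.IsHermitian) {f : ι → ℝ → ℂ}
    {g : ℝ → ℂ} (h : ∀ i, Tendsto (fun n => f n (hA.eigenvalues i)) l (𝓝 (g (hA.eigenvalues i)))) :
    Tendsto (fun n => spectralMap hA (f n)) l (𝓝 (spectralMap hA g)) := by
  unfold spectralMap
  have hd : Tendsto (fun n => diagonal (fun i => f n (hA.eigenvalues i))) l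
      (𝓝 (diagonal (fun i => g (hA.eigenvalues i)))) :=
    ((continuous_id.matrix_diagonal (n := m) (R := ℂ)).tendsto _).comp (tendsto_pi_nhds.2 h)
  exact (tendsto_const_nhds.mul hd).mul tendsto_const_nhds

open scoped ComplexOrder

theorem exp_cfc_log (hA : A.PosDef) :
    NormedSpace.exp (cfc Real.log A) = A := by
  have h := exp_smul_cfc hA.1 1 Real.log
  rw [one_smul] at h
  rw [h]
  conv_rhs => rw [eq_spectralMap_id hA.1]
  refine spectralMap_congr hA.1 fun i => ?_
  rw [one_mul, ← Complex.ofReal_exp, Real.exp_log (hA.eigenvalues_pos i)]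

theorem posSemidef_cfc {f : ℝ → ℝ} (hA : A.IsHermitian) (hf : ∀ i, 0 ≤ f (hA.eigenvalues i)) :
    (cfc f A).PosSemidef := by
  rw [cfc_eq_spectralMap hA]
  refine (PosSemidef.diagonal (d := fun i => (f (hA.eigenvalues i) : ℂ))
    fun i => ?_).mul_mul_conjTranspose_same _
  exact Complex.zero_le_real.2 (hf i)

theorem cfc_mul_cfc_eq (hA : A.IsHermitian) (f g : ℝ → ℝ) :
    cfc f A * cfc g A = cfc (fun x => f x * g x) A := by
  simp_rw [cfc_eq_spectralMap hA]
  rw [spectralMap_mul]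
  refine spectralMap_congr hA fun i => ?_
  push_cast; rfl

theorem cfc_sqrt_mul_self (hA : A.PosSemidef) : cfc Real.sqrt A * cfc Real.sqrt A = A := by
  rw [cfc_mul_cfc_eq hA.1]
  conv_rhs => rw [eq_spectralMap_id hA.1]
  rw [cfc_eq_spectralMap hA.1]
  refine spectralMap_congr hA.1 fun i => ?_
  rw [Real.mul_self_sqrt (hA.eigenvalues_nonneg i)]

theorem cfc_sqrt_posSemidef (hA : A.PosSemidef) : (cfc Real.sqrt A).PosSemidef :=
  posSemidef_cfc hA.1 fun _ => Real.sqrt_nonneg _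

end SpectralMap

/-! ### Interpolation of Schatten norms by the three lines theorem. -/

section ThreeLines

variable {m : Type*} [Fintype m] [DecidableEq m]

theorem re_trace_conjTranspose_mul_self (X : Matrix m m ℂ) :
    (Xᴴ * X).trace.re = ∑ p : m × m, ‖X p.1 p.2‖ ^ 2 := by
  rw [Fintype.sum_prod_type_right]
  simp only [trace, diag, mul_apply, conjTranspose_apply, Complex.re_sum]
  refine Finset.sum_congr rfl fun i _ => Finset.sum_congr rfl fun j _ => ?_
  rw [← Complex.normSq_eq_norm_sq, Complex.star_def, Complex.conj_mul', ← Complex.ofReal_pow,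
    Complex.ofReal_re, Complex.normSq_eq_norm_sq]

theorem re_trace_conjTranspose_mul_self_nonneg (X : Matrix m m ℂ) :
    0 ≤ (Xᴴ * X).trace.re := by
  rw [re_trace_conjTranspose_mul_self]; positivity

/-- The Cauchy–Schwarz inequality for the Hilbert–Schmidt inner product. -/
theorem norm_trace_mul_le (X Y : Matrix m m ℂ) :
    ‖(X * Y).trace‖ ≤ √((X * Xᴴ).trace.re) * √((Yᴴ * Y).trace.re) := by
  rw [trace_mul_comm X Xᴴ, re_trace_conjTranspose_mul_self, re_trace_conjTranspose_mul_self]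
  have h : (X * Y).trace = ∑ p : m × m, X p.1 p.2 * Y p.2 p.1 := by
    rw [Fintype.sum_prod_type]; simp [trace, mul_apply]
  rw [h]
  have h2 : ∑ p : m × m, ‖Y p.1 p.2‖ ^ 2 = ∑ p : m × m, ‖Y p.2 p.1‖ ^ 2 := by
    rw [Fintype.sum_prod_type, Fintype.sum_prod_type, Finset.sum_comm]
  rw [h2]
  refine (norm_sum_le _ _).trans ?_
  simp_rw [norm_mul]
  exact Real.sum_mul_le_sqrt_mul_sqrt _ _ _

open scoped Matrix.Norms.L2Operator

theorem norm_trace_le (X : Matrix m m ℂ) : ‖X.trace‖ ≤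
    ‖LinearMap.toContinuousLinearMap (traceLinearMap m ℂ ℂ)‖ * ‖X‖ :=
  (LinearMap.toContinuousLinearMap (traceLinearMap m ℂ ℂ)).le_opNorm X

theorem exp_add_smul (a : Matrix m m ℂ) (x y : ℂ) :
    NormedSpace.exp ((x + y) • a) = NormedSpace.exp (x • a) * NormedSpace.exp (y • a) := by
  rw [add_smul]
  exact Matrix.exp_add_of_commute _ _ ((Commute.refl a).smul_left x |>.smul_right y)

theorem exp_smul_conjTranspose {a : Matrix m m ℂ} (ha : a.IsHermitian) (z : ℂ) :
    (NormedSpace.exp (z • a))ᴴ = NormedSpace.exp (star z • a) := by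
  rw [← Matrix.exp_conjTranspose, conjTranspose_smul, ha.eq]

theorem exp_smul_I_unitary {a : Matrix m m ℂ} (ha : a.IsHermitian) {z : ℂ} (hz : z.re = 0) :
    (NormedSpace.exp (z • a))ᴴ * NormedSpace.exp (z • a) = 1 := by
  have h : star z + z = 0 := by
    apply Complex.ext <;> simp [hz]
  rw [exp_smul_conjTranspose ha, ← exp_add_smul, h, zero_smul, NormedSpace.exp_zero]

theorem norm_le_one_of_conjTranspose_mul_self {u : Matrix m m ℂ} (hu : uᴴ * u = 1) : ‖u‖ ≤ 1 := by
  rcases subsingleton_or_nontrivial (Matrix m m ℂ) with h | h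
  · rw [Subsingleton.elim u 0]; simp
  · exact (CStarRing.norm_of_mem_unitary (E := Matrix m m ℂ)
      (Unitary.mem_iff.2 ⟨hu, mul_eq_one_comm.1 hu⟩)).le

theorem differentiable_exp_smul (a : Matrix m m ℂ) :
    Differentiable ℂ (fun z : ℂ => NormedSpace.exp (z • a)) :=
  fun z => (hasDerivAt_exp_smul_const a z).differentiableAt

/-- On vertical strips, the matrices `exp (z a)` with `a` Hermitian are bounded. -/
theorem exists_norm_exp_smul_le {a : Matrix m m ℂ} (ha : a.IsHermitian) (l u : ℝ) :
    ∃ C, ∀ z : ℂ, z.re ∈ Set.Icc l u → ‖NormedSpace.exp (z • a)‖ ≤ C := by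
  have hc : ContinuousOn (fun x : ℝ => ‖NormedSpace.exp ((x : ℂ) • a)‖) (Set.Icc l u) :=
    ((differentiable_exp_smul a).continuous.comp Complex.continuous_ofReal).norm.continuousOn
  obtain ⟨C, hC⟩ := (isCompact_Icc.image_of_continuousOn hc).bddAbove
  refine ⟨C, fun z hz => ?_⟩
  have h1 := norm_le_one_of_conjTranspose_mul_self
    (exp_smul_I_unitary ha (z := (z.im : ℂ) * Complex.I) (by simp))
  have h2 : ‖NormedSpace.exp ((z.re : ℂ) • a)‖ ≤ C := hC ⟨z.re, hz, rfl⟩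
  calc ‖NormedSpace.exp (z • a)‖
      = ‖NormedSpace.exp ((z.re : ℂ) • a) * NormedSpace.exp (((z.im : ℂ) * Complex.I) • a)‖ := by
        rw [← exp_add_smul, Complex.re_add_im]
    _ ≤ ‖NormedSpace.exp ((z.re : ℂ) • a)‖ * ‖NormedSpace.exp (((z.im : ℂ) * Complex.I) • a)‖ :=
        norm_mul_le _ _
    _ ≤ ‖NormedSpace.exp ((z.re : ℂ) • a)‖ * 1 := by gcongr
    _ ≤ C := by rwa [mul_one]

/-- Complex interpolation between the operator norm on `Re z = 0` and the Hilbert–Schmidt norm on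
`Re z = 1`, at the points `1 / N`. -/
theorem re_trace_pow_le_of_strip {G : ℂ → Matrix m m ℂ} (hd : Differentiable ℂ G)
    (hb : ∃ C, ∀ z : ℂ, z.re ∈ Set.Icc (0 : ℝ) 1 → ‖G z‖ ≤ C)
    (h0 : ∀ z : ℂ, z.re = 0 → (G z)ᴴ * G z = 1) {S : ℝ}
    (h1 : ∀ z : ℂ, z.re = 1 → ((G z)ᴴ * G z).trace.re ≤ S) {N : ℕ} (hN : 1 ≤ N)
    (hu : IsUnit (G ((N : ℂ)⁻¹))) :
    (((G ((N : ℂ)⁻¹))ᴴ * G ((N : ℂ)⁻¹)) ^ N).trace.re ≤ S := by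
  have hS : 0 ≤ S := (re_trace_conjTranspose_mul_self_nonneg _).trans (h1 1 (by simp))
  set X := G ((N : ℂ)⁻¹) with hX
  set Q := Xᴴ * X with hQ
  have hN0 : (N : ℂ) ≠ 0 := by exact_mod_cast (by omega : N ≠ 0)
  open scoped ComplexOrder in
  have hQpos : Q.PosDef := PosDef.conjTranspose_mul_self X
    (Matrix.mulVec_injective_iff_isUnit.2 hu)
  set h := cfc Real.log Q with hh
  have hherm : h.IsHermitian := isHermitian_cfc _ _
  have hexp : NormedSpace.exp h = Q := exp_cfc_log hQpos
  have hexp' : NormedSpace.exp ((1 : ℂ) • h) = Q := by rw [one_smul, hexp]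
  set E : ℂ → Matrix m m ℂ := fun z => NormedSpace.exp (z • h) with hE
  have hEadd : ∀ x y, E x * E y = E (x + y) := fun x y => (exp_add_smul h x y).symm
  have hEstar : ∀ x, (E x)ᴴ = E (star x) := fun x => exp_smul_conjTranspose hherm x
  have hE0 : E 0 = 1 := by simp [hE]
  set B := E (N / 2) with hB
  -- The adjoint of the unitary polar factor of `X`, so that `W * X` is the square root of `Q`.
  set W := E (-(1 / 2)) * Xᴴ with hW
  have hWW : W * Wᴴ = 1 := by
    rw [hW, conjTranspose_mul, conjTranspose_conjTranspose, hEstar]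
    calc _ = E (-(1 / 2)) * (Xᴴ * X) * E (star (-(1 / 2))) := by simp only [Matrix.mul_assoc]
      _ = E (-(1 / 2)) * E 1 * E (star (-(1 / 2))) := by rw [← hQ, ← hexp']
      _ = 1 := by
        rw [hEadd, hEadd, ← hE0]; congr 1
        simp; norm_num
  have hpow : Q ^ N = E N := by
    rw [← hexp, ← Matrix.exp_nsmul, hE]
    simp only
    rw [Nat.cast_smul_eq_nsmul]
  have hBB : B * B = E N := by rw [hB, hEadd]; congr 1; ring
  have hBstar : Bᴴ = B := by rw [hB, hEstar]; simp
  have hBE : ∀ x, B * E x = E x * B := fun x => by rw [hB, hEadd, hEadd, add_comm]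
  set T := (E N).trace.re with hT
  have hT0 : 0 ≤ T := by
    have := re_trace_conjTranspose_mul_self_nonneg B
    rwa [hBstar, hBB] at this
  rw [hpow]
  change T ≤ S
  -- `F` pairs `G z` with its dual element in the Schatten scale. The modulus of `E ((2 - z) * (N /
  -- 2))` is `Q ^ N` on `Re z = 0` (trace norm `T`) and `Q ^ (N / 2)` on `Re z = 1` (Hilbert–Schmidt
  -- norm `√T`). At `z = 1 / N` the exponents add up to `N - 1/2 - 1/2 + 1 = N`, so `F` equals `tr Q
  -- ^ N` there.
  set F : ℂ → ℂ := fun z => (E ((2 - z) * (N / 2)) * W * G z).trace with hF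
  have hVV : ∀ z : ℂ, z.re = 0 → E (-z * (N / 2)) * (E (-z * (N / 2)))ᴴ = 1 := by
    intro z hz
    rw [hEstar, hEadd, ← hE0]
    congr 1
    apply Complex.ext <;> simp [hz]
  have hF0 : ∀ z : ℂ, z.re = 0 → ‖F z‖ ≤ T := by
    intro z hz
    have e : F z = (B * (B * (E (-z * (N / 2)) * W * G z))).trace := by
      rw [hF]
      simp only [← Matrix.mul_assoc]
      rw [hB, hEadd, hEadd]
      congr 5; ring
    rw [e]
    refine (norm_trace_mul_le _ _).trans ?_
    have e2 : ((B * (E (-z * (N / 2)) * W * G z))ᴴ * (B * (E (-z * (N / 2)) * W * G z))).trace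
        = (E N).trace := by
      set V := E (-z * (N / 2)) with hV
      have hGG : G z * (G z)ᴴ = 1 := mul_eq_one_comm.1 (h0 z hz)
      have : (V * W * G z) * (V * W * G z)ᴴ = 1 := by
        simp only [conjTranspose_mul]
        calc _ = V * (W * (G z * (G z)ᴴ) * Wᴴ) * Vᴴ := by simp only [Matrix.mul_assoc]
          _ = 1 := by rw [hGG, Matrix.mul_one, hWW, Matrix.mul_one, hVV z hz]
      rw [trace_mul_comm, conjTranspose_mul, hBstar]
      calc _ = (B * ((V * W * G z) * (V * W * G z)ᴴ) * B).trace := by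
            simp only [Matrix.mul_assoc]
        _ = _ := by rw [this, Matrix.mul_one, hBB]
    rw [e2, hBstar, hBB, Real.mul_self_sqrt hT0]
  have hF1 : ∀ z : ℂ, z.re = 1 → ‖F z‖ ≤ √T * √S := by
    intro z hz
    refine (norm_trace_mul_le _ _).trans ?_
    have e : (E ((2 - z) * (N / 2)) * W * (E ((2 - z) * (N / 2)) * W)ᴴ) = E N := by
      rw [conjTranspose_mul]
      calc _ = E ((2 - z) * (N / 2)) * (W * Wᴴ) * (E ((2 - z) * (N / 2)))ᴴ := by
            simp only [Matrix.mul_assoc]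
        _ = _ := by
          rw [hWW, Matrix.mul_one, hEstar, hEadd]
          congr 1
          apply Complex.ext <;> simp [hz]
          ring
    rw [e]
    gcongr
    exact h1 z hz
  have hFd : Differentiable ℂ F := by
    have d1 : Differentiable ℂ (fun z : ℂ => E ((2 - z) * (N / 2))) :=
      (differentiable_exp_smul h).comp (by fun_prop : Differentiable ℂ fun z : ℂ =>
        (2 - z) * ((N : ℂ) / 2))
    have d2 : Differentiable ℂ (fun z : ℂ => E ((2 - z) * (N / 2)) * W * G z) :=
      (d1.mul (differentiable_const W)).mul hd
    exact (LinearMap.toContinuousLinearMap (traceLinearMap m ℂ ℂ)).differentiable.comp d2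
  have hFb : BddAbove ((norm ∘ F) '' Complex.HadamardThreeLines.verticalClosedStrip 0 1) := by
    obtain ⟨C, hC⟩ := hb
    obtain ⟨C', hC'⟩ := exists_norm_exp_smul_le hherm (N / 2) N
    refine ⟨‖LinearMap.toContinuousLinearMap (traceLinearMap m ℂ ℂ)‖ * (C' * ‖W‖ * C), ?_⟩
    rintro _ ⟨z, hz, rfl⟩
    have hz' : z.re ∈ Set.Icc (0 : ℝ) 1 := hz
    have hE' : ‖E ((2 - z) * (N / 2))‖ ≤ C' := by
      apply hC'
      have : ((2 - z) * (N / 2 : ℂ)).re = (2 - z.re) * (N / 2) := by simp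
      rw [this]
      have hNn : (0 : ℝ) ≤ N := by positivity
      constructor <;> nlinarith [hz'.1, hz'.2]
    refine (norm_trace_le _).trans ?_
    gcongr
    refine (norm_mul_le _ _).trans ?_
    refine mul_le_mul ((norm_mul_le _ _).trans ?_) (hC z hz') (norm_nonneg _) ?_
    · gcongr
    · exact mul_nonneg ((norm_nonneg _).trans hE') (norm_nonneg _)
  have hre : ((N : ℂ)⁻¹).re = (N : ℝ)⁻¹ := by
    rw [← Complex.ofReal_natCast, ← Complex.ofReal_inv, Complex.ofReal_re]
  have hN1 : (1 : ℝ) ≤ N := by exact_mod_cast hN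
  have key := Complex.HadamardThreeLines.norm_le_interp_of_mem_verticalClosedStrip₀₁' F
    (z := (N : ℂ)⁻¹) (a := T) (b := √T * √S) (by
      refine ⟨?_, ?_⟩ <;> rw [hre]
      · positivity
      · exact inv_le_one_of_one_le₀ hN1) hFd.diffContOnCl hFb hF0 hF1
  have hFN : F ((N : ℂ)⁻¹) = (E N).trace := by
    rw [hF]
    simp only
    rw [← hX, hW]
    congr 1
    calc _ = E ((2 - (N : ℂ)⁻¹) * (N / 2)) * E (-(1 / 2)) * (Xᴴ * X) := by
          simp only [Matrix.mul_assoc]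
      _ = _ := by
        rw [← hQ, ← hexp']
        change _ * _ * E 1 = _
        rw [hEadd, hEadd]
        congr 1
        field_simp
        ring
  rw [hFN, hre] at key
  -- Since `T` occurs on both sides, cancelling its powers leaves `T ≤ S`.
  have hTle : T ≤ T ^ (1 - (N : ℝ)⁻¹) * (√T * √S) ^ (N : ℝ)⁻¹ :=
    (Complex.re_le_norm _).trans key
  rcases hT0.eq_or_lt with hT' | hT'
  · rw [← hT']; exact hS
  set θ := (N : ℝ)⁻¹ with hθ
  have hθ0 : 0 < θ := by positivity
  rw [Real.rpow_sub hT', Real.rpow_one, div_mul_eq_mul_div, le_div_iff₀ (by positivity)] at hTle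
  have h3 : T ^ θ ≤ (√T * √S) ^ θ := le_of_mul_le_mul_left hTle hT'
  have h4 : T ≤ √T * √S := (Real.rpow_le_rpow_iff hT0 (by positivity) hθ0).1 h3
  have h5 : √T * √T ≤ √T * √S := by rwa [Real.mul_self_sqrt hT0]
  have h6 : √T ≤ √S := le_of_mul_le_mul_left h5 (Real.sqrt_pos.2 hT')
  exact (Real.sqrt_le_sqrt_iff hS).1 h6

end ThreeLines

/-! ### The Lie–Trotter formula and the four-matrix Golden–Thompson inequality. -/

section Trotter

theorem norm_pow_sub_pow_le {R : Type*} [NormedRing R] [NormOneClass R] (x y : R) {c : ℝ}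
    (hx : ‖x‖ ≤ c) (hy : ‖y‖ ≤ c) (n : ℕ) :
    ‖x ^ n - y ^ n‖ ≤ n * c ^ (n - 1) * ‖x - y‖ := by
  have hc : 0 ≤ c := (norm_nonneg _).trans hx
  induction n with
  | zero => simp
  | succ n ih =>
    have e : x ^ (n + 1) - y ^ (n + 1) = x ^ n * (x - y) + (x ^ n - y ^ n) * y := by
      rw [pow_succ, pow_succ]; noncomm_ring
    have h1 : ‖x ^ n * (x - y)‖ ≤ c ^ n * ‖x - y‖ := by
      refine (norm_mul_le _ _).trans ?_
      gcongr
      exact (norm_pow_le x n).trans (by gcongr)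
    have h2 : ‖(x ^ n - y ^ n) * y‖ ≤ n * c ^ (n - 1) * ‖x - y‖ * c := by
      refine (norm_mul_le _ _).trans ?_
      exact mul_le_mul ih hy (norm_nonneg _) (by positivity)
    rw [e]
    refine (norm_add_le _ _).trans ((add_le_add h1 h2).trans (le_of_eq ?_))
    rcases n with _ | n
    · simp
    · simp only [Nat.add_sub_cancel, Nat.cast_add, Nat.cast_one]
      ring

/-- The Lie–Trotter product formula along a differentiable curve through `1`. -/
theorem tendsto_pow_exp_of_hasDerivAt {R : Type*} [NormedRing R] [NormOneClass R]
    [NormedAlgebra ℝ R] [CompleteSpace R] {Q : ℝ → R} {H : R} (hQ : HasDerivAt Q H 0)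
    (h0 : Q 0 = 1) :
    Tendsto (fun N : ℕ => Q ((N : ℝ)⁻¹) ^ N) atTop (𝓝 (NormedSpace.exp H)) := by
  have : NormedAlgebra ℚ R := NormedAlgebra.restrictScalars ℚ ℝ R
  have hE : HasDerivAt (fun t : ℝ => NormedSpace.exp (t • H)) H 0 := by
    simpa using hasDerivAt_exp_smul_const (𝕂 := ℝ) H 0
  have hinv : Tendsto (fun N : ℕ => (N : ℝ)⁻¹) atTop (𝓝[≠] 0) := by
    refine tendsto_nhdsWithin_iff.2 ⟨tendsto_inv_atTop_nhds_zero_nat, ?_⟩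
    filter_upwards [eventually_gt_atTop 0] with N hN
    simp; omega
  have hexpN : ∀ N : ℕ, 1 ≤ N →
      NormedSpace.exp ((N : ℝ)⁻¹ • H) ^ N = NormedSpace.exp H := by
    intro N hN
    rw [← NormedSpace.exp_nsmul, ← Nat.cast_smul_eq_nsmul ℝ, smul_smul,
      mul_inv_cancel₀ (by positivity), one_smul]
  have hslope : ∀ {f : ℝ → R}, HasDerivAt f H 0 → f 0 = 1 →
      Tendsto (fun N : ℕ => (N : ℝ) • (f ((N : ℝ)⁻¹) - 1)) atTop (𝓝 H) := by
    intro f hf hf0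
    have := (hasDerivAt_iff_tendsto_slope.1 hf).comp hinv
    refine this.congr fun N => ?_
    simp [slope, hf0]
  have hQ' := hslope hQ h0
  have hE' := hslope hE (by simp)
  -- Both curves are `1 + H / N + o(1 / N)`. Taking `N`-th powers multiplies the error by at most
  -- `N` times `exp K`, because both bases have norm at most `exp (K / N)`.
  have hdiff : Tendsto (fun N : ℕ => (N : ℝ) * ‖Q ((N : ℝ)⁻¹) - NormedSpace.exp ((N : ℝ)⁻¹ • H)‖)
      atTop (𝓝 0) := by
    have := (hQ'.sub hE').norm
    rw [sub_self, norm_zero] at this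
    refine this.congr fun N => ?_
    rw [← smul_sub, sub_sub_sub_cancel_right, norm_smul]
    simp
  set K := ‖H‖ + 1 with hK
  have hbound : ∀ {f : ℝ → R}, Tendsto (fun N : ℕ => (N : ℝ) • (f ((N : ℝ)⁻¹) - 1)) atTop (𝓝 H) →
      ∀ᶠ N : ℕ in atTop, ‖f ((N : ℝ)⁻¹)‖ ≤ Real.exp (K / N) := by
    intro f hf
    filter_upwards [hf.norm.eventually_le_const (u := K) (by rw [hK]; linarith),
      eventually_ge_atTop 1] with N hN hN1
    have hNp : (0 : ℝ) < N := by positivity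
    have h1 : ‖f ((N : ℝ)⁻¹) - 1‖ ≤ K / N := by
      rw [norm_smul] at hN
      rw [le_div_iff₀ hNp, mul_comm]
      simpa using hN
    calc ‖f ((N : ℝ)⁻¹)‖ = ‖(f ((N : ℝ)⁻¹) - 1) + 1‖ := by rw [sub_add_cancel]
      _ ≤ ‖f ((N : ℝ)⁻¹) - 1‖ + ‖(1 : R)‖ := norm_add_le _ _
      _ ≤ K / N + 1 := by rw [norm_one]; gcongr
      _ ≤ Real.exp (K / N) := Real.add_one_le_exp _
  rw [tendsto_iff_norm_sub_tendsto_zero]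
  refine squeeze_zero' (g := fun N : ℕ => Real.exp K *
    ((N : ℝ) * ‖Q ((N : ℝ)⁻¹) - NormedSpace.exp ((N : ℝ)⁻¹ • H)‖))
    (Eventually.of_forall fun _ => norm_nonneg _) ?_ (by simpa using hdiff.const_mul (Real.exp K))
  filter_upwards [hbound hQ',
    hbound (f := fun t => NormedSpace.exp (t • H)) hE', eventually_ge_atTop 1] with N h1 h2 hN
  rw [← hexpN N hN]
  refine (norm_pow_sub_pow_le _ _ h1 h2 N).trans ?_
  have hNp : (0 : ℝ) < N := by positivity
  have h3 : Real.exp (K / N) ^ (N - 1) ≤ Real.exp K := by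
    rw [← Real.exp_nat_mul]
    apply Real.exp_le_exp.2
    have hle : ((N - 1 : ℕ) : ℝ) ≤ N := by exact_mod_cast Nat.sub_le _ _
    calc ((N - 1 : ℕ) : ℝ) * (K / N) ≤ N * (K / N) := by gcongr
      _ = K := by field_simp
  calc _ ≤ N * Real.exp K * ‖Q ((N : ℝ)⁻¹) - NormedSpace.exp ((N : ℝ)⁻¹ • H)‖ := by gcongr
    _ = _ := by ring

variable {m : Type*} [Fintype m] [DecidableEq m]

open scoped Matrix.Norms.L2Operator

/-- The product `exp (z w / 2) exp (z k / 2) exp (z b / 2) exp (z l / 2)`. -/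
def expProd (w k b l : Matrix m m ℂ) (z : ℂ) : Matrix m m ℂ :=
  NormedSpace.exp ((z / 2) • w) * NormedSpace.exp ((z / 2) • k) *
    NormedSpace.exp ((z / 2) • b) * NormedSpace.exp ((z / 2) • l)

theorem hasDerivAt_exp_half_smul (a : Matrix m m ℂ) (z : ℂ) :
    HasDerivAt (fun z : ℂ => NormedSpace.exp ((z / 2) • a))
      ((2⁻¹ : ℂ) • (NormedSpace.exp ((z / 2) • a) * a)) z := by
  have h1 : HasDerivAt (fun z : ℂ => z / 2) 2⁻¹ z := by
    simpa using (hasDerivAt_id z).div_const 2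
  exact HasDerivAt.scomp z (hasDerivAt_exp_smul_const a (z / 2)) h1

theorem hasDerivAt_expProd (w k b l : Matrix m m ℂ) :
    HasDerivAt (expProd w k b l) ((2⁻¹ : ℂ) • (w + k + b + l)) 0 := by
  have h := (((hasDerivAt_exp_half_smul w 0).mul (hasDerivAt_exp_half_smul k 0)).mul
    (hasDerivAt_exp_half_smul b 0)).mul (hasDerivAt_exp_half_smul l 0)
  refine h.congr_deriv ?_
  simp [smul_add, NormedSpace.exp_zero]

theorem differentiable_expProd (w k b l : Matrix m m ℂ) : Differentiable ℂ (expProd w k b l) := by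
  intro z
  exact ((((hasDerivAt_exp_half_smul w z).mul (hasDerivAt_exp_half_smul k z)).mul
    (hasDerivAt_exp_half_smul b z)).mul (hasDerivAt_exp_half_smul l z)).differentiableAt

/-- A four-matrix extension of the Golden–Thompson inequality, with a supremum over imaginary
powers. -/
theorem re_trace_exp_add_le {w k b l : Matrix m m ℂ} (hw : w.IsHermitian) (hk : k.IsHermitian)
    (hb : b.IsHermitian) (hl : l.IsHermitian) {S : ℝ}
    (hS : ∀ z : ℂ, z.re = 1 → ((expProd w k b l z)ᴴ * expProd w k b l z).trace.re ≤ S) :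
    (NormedSpace.exp (w + k + b + l)).trace.re ≤ S := by
  -- For empty `m` the matrix ring is zero and `‖1‖ = 1` fails, so Lie–Trotter does not apply.
  rcases isEmpty_or_nonempty m with hm | hm
  · have := (re_trace_conjTranspose_mul_self_nonneg _).trans (hS 1 rfl)
    simpa [trace] using this
  set G := expProd w k b l with hG
  have hunit : ∀ z, IsUnit (G z) := fun z =>
    (((Matrix.isUnit_exp _).mul (Matrix.isUnit_exp _)).mul (Matrix.isUnit_exp _)).mul
      (Matrix.isUnit_exp _)
  have hbd : ∃ C, ∀ z : ℂ, z.re ∈ Set.Icc (0 : ℝ) 1 → ‖G z‖ ≤ C := by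
    have hh : ∀ {a : Matrix m m ℂ}, a.IsHermitian → ∃ C, 0 ≤ C ∧ ∀ z : ℂ, z.re ∈ Set.Icc (0 : ℝ) 1 →
        ‖NormedSpace.exp ((z / 2) • a)‖ ≤ C := by
      intro a ha
      obtain ⟨C, hC⟩ := exists_norm_exp_smul_le ha 0 1
      have hC' : ∀ z : ℂ, z.re ∈ Set.Icc (0 : ℝ) 1 → ‖NormedSpace.exp ((z / 2) • a)‖ ≤ C := by
        intro z hz
        refine hC _ ?_
        have : (z / 2).re = z.re / 2 := by simp
        rw [this]
        constructor <;> linarith [hz.1, hz.2]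
      exact ⟨C, (norm_nonneg _).trans (hC' 0 (by simp)), hC'⟩
    obtain ⟨C1, p1, h1⟩ := hh hw
    obtain ⟨C2, p2, h2⟩ := hh hk
    obtain ⟨C3, p3, h3⟩ := hh hb
    obtain ⟨C4, p4, h4⟩ := hh hl
    refine ⟨C1 * C2 * C3 * C4, fun z hz => ?_⟩
    refine norm_mul_le_of_le (norm_mul_le_of_le (norm_mul_le_of_le (h1 z hz) (h2 z hz)) (h3 z hz))
      (h4 z hz)
  have hun : ∀ z : ℂ, z.re = 0 → (G z)ᴴ * G z = 1 := by
    intro z hz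
    have hz' : (z / 2).re = 0 := by simp [hz]
    have u : ∀ {a : Matrix m m ℂ}, a.IsHermitian →
        NormedSpace.exp ((z / 2) • a) ∈ unitary (Matrix m m ℂ) := fun {a} ha =>
      Unitary.mem_iff.2 ⟨exp_smul_I_unitary ha hz',
        mul_eq_one_comm.1 (exp_smul_I_unitary ha hz')⟩
    exact (Unitary.mem_iff.1 (mul_mem (mul_mem (mul_mem (u hw) (u hk)) (u hb)) (u hl))).1
  set Q : ℝ → Matrix m m ℂ := fun x => (G x)ᴴ * G x with hQ
  have hGd : HasDerivAt (fun x : ℝ => G x) ((2⁻¹ : ℂ) • (w + k + b + l)) 0 := by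
    have h1 : HasDerivAt (fun x : ℝ => (x : ℂ)) 1 0 := Complex.ofRealCLM.hasDerivAt
    have h2 : HasDerivAt G ((2⁻¹ : ℂ) • (w + k + b + l)) ((0 : ℝ) : ℂ) := by
      simpa using hasDerivAt_expProd w k b l
    have h3 := HasDerivAt.scomp (0 : ℝ) h2 h1
    rw [one_smul] at h3
    exact h3
  have hsum : (w + k + b + l).IsHermitian := ((hw.add hk).add hb).add hl
  -- Each of `G` and its adjoint contributes half of the sum; this is why `expProd` carries `z / 2`.
  have hQd : HasDerivAt Q (w + k + b + l) 0 := by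
    have hG0 : G ((0 : ℝ) : ℂ) = 1 := by simp [hG, expProd]
    have h := (hGd.star).mul hGd
    refine h.congr_deriv ?_
    simp only [hG0, star_one, mul_one, one_mul]
    rw [star_eq_conjTranspose, conjTranspose_smul, hsum.eq, ← add_smul]
    norm_num
  have hQ0 : Q 0 = 1 := by simp [hQ, hG, expProd]
  have hlim := tendsto_pow_exp_of_hasDerivAt hQd hQ0
  have hlim' : Tendsto (fun N : ℕ => ((Q ((N : ℝ)⁻¹)) ^ N).trace.re) atTop
      (𝓝 (NormedSpace.exp (w + k + b + l)).trace.re) :=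
    ((Complex.continuous_re.comp (continuous_id.matrix_trace)).tendsto _).comp hlim
  refine le_of_tendsto hlim' ?_
  filter_upwards [eventually_ge_atTop 1] with N hN
  have hc : (((N : ℝ)⁻¹ : ℝ) : ℂ) = (N : ℂ)⁻¹ := by push_cast; rfl
  have := re_trace_pow_le_of_strip (differentiable_expProd w k b l) hbd hun hS hN (hunit _)
  simp only [hQ]
  rwa [hc]

end Trotter

/-! ### The Gibbs variational principle. -/

section Gibbs

variable {m : Type*} [Fintype m] [DecidableEq m]

open scoped ComplexOrder

theorem trace_spectralMap_mul_spectralMap {A X : Matrix m m ℂ} (hA : A.IsHermitian)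
    (hX : X.IsHermitian) (f g : ℝ → ℂ) :
    (spectralMap hA f * spectralMap hX g).trace = ∑ i, ∑ j, f (hA.eigenvalues i) *
      g (hX.eigenvalues j) * (Complex.normSq ((star (hA.eigenvectorUnitary : Matrix m m ℂ) *
        (hX.eigenvectorUnitary : Matrix m m ℂ)) i j) : ℂ) := by
  set U := (hA.eigenvectorUnitary : Matrix m m ℂ)
  set V := (hX.eigenvectorUnitary : Matrix m m ℂ)
  set W := star U * V with hW
  have h : (spectralMap hA f * spectralMap hX g).trace =
      (diagonal (fun i => f (hA.eigenvalues i)) * W * diagonal (fun i => g (hX.eigenvalues i)) *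
        Wᴴ).trace := by
    have : Wᴴ = star V * U := by
      rw [hW, conjTranspose_mul, star_eq_conjTranspose, conjTranspose_conjTranspose]; rfl
    rw [this, hW, spectralMap, spectralMap, Matrix.mul_assoc, Matrix.mul_assoc, trace_mul_comm]
    simp only [Matrix.mul_assoc]
    rfl
  rw [h]
  simp only [trace, diag]
  refine Finset.sum_congr rfl fun i _ => ?_
  rw [mul_apply]
  refine Finset.sum_congr rfl fun j _ => ?_
  rw [mul_diagonal, diagonal_mul, conjTranspose_apply, Complex.normSq_eq_conj_mul_self, Complex.star_def]
  ring

/-- Young's inequality for the Legendre pair `r log r - r` and `exp x`; it is the scalar form of the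
Gibbs principle. -/
theorem mul_le_mul_log_add_exp_sub {r : ℝ} (hr : 0 ≤ r) (x : ℝ) :
    r * x ≤ r * Real.log r + Real.exp x - r := by
  rcases hr.eq_or_lt with rfl | hr
  · simp [Real.exp_nonneg]
  · have h := Real.add_one_le_exp (x - Real.log r)
    rw [Real.exp_sub, Real.exp_log hr, le_div_iff₀ hr] at h
    nlinarith

/-- The Gibbs variational principle. -/
theorem re_trace_mul_le {ρ X : Matrix m m ℂ} (hρ : ρ.PosSemidef) (hX : X.IsHermitian) :
    (ρ * X).trace.re ≤ (ρ * cfc Real.log ρ).trace.re + (NormedSpace.exp X).trace.re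
      - ρ.trace.re := by
  -- All four traces are sums over pairs of eigenvectors with the same nonnegative overlap weights,
  -- so the claim reduces to the scalar inequality term by term.
  set c : m → m → ℝ := fun i j => Complex.normSq ((star (hρ.1.eigenvectorUnitary : Matrix m m ℂ) *
        (hX.eigenvectorUnitary : Matrix m m ℂ)) i j)
  have key : ∀ f g : ℝ → ℝ, (spectralMap hρ.1 (fun x => (f x : ℂ)) *
      spectralMap hX (fun x => (g x : ℂ))).trace.re =
      ∑ i, ∑ j, f (hρ.1.eigenvalues i) * g (hX.eigenvalues j) * c i j := by
    intro f g
    rw [trace_spectralMap_mul_spectralMap, Complex.re_sum]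
    simp_rw [Complex.re_sum]
    refine Finset.sum_congr rfl fun i _ => Finset.sum_congr rfl fun j _ => ?_
    norm_cast
  have e1 := key (fun x => x) (fun x => x)
  have e2 := key (fun x => x * Real.log x) (fun _ => 1)
  have e3 := key (fun _ => 1) Real.exp
  have e4 := key (fun x => x) (fun _ => 1)
  rw [← eq_spectralMap_id, ← eq_spectralMap_id] at e1
  have o1 : spectralMap hX (fun _ => ((1 : ℝ) : ℂ)) = 1 := by
    simpa using spectralMap_const_one hX
  have o2 : spectralMap hρ.1 (fun _ => ((1 : ℝ) : ℂ)) = 1 := by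
    simpa using spectralMap_const_one hρ.1
  have o3 : spectralMap hX (fun x => (Real.exp x : ℂ)) = NormedSpace.exp X := by
    conv_rhs => rw [eq_spectralMap_id hX, exp_spectralMap]
    simp
  have o4 : spectralMap hρ.1 (fun x => ((x * Real.log x : ℝ) : ℂ)) = ρ * cfc Real.log ρ := by
    conv_rhs => rw [cfc_eq_spectralMap hρ.1]; arg 1; rw [eq_spectralMap_id hρ.1]
    rw [spectralMap_mul]
    simp
  rw [o1, Matrix.mul_one, o4] at e2
  rw [o2, Matrix.one_mul, o3] at e3
  rw [o1, Matrix.mul_one, ← eq_spectralMap_id] at e4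
  rw [e1, e2, e3, e4, ← Finset.sum_add_distrib, ← Finset.sum_sub_distrib]
  refine Finset.sum_le_sum fun i _ => ?_
  rw [← Finset.sum_add_distrib, ← Finset.sum_sub_distrib]
  refine Finset.sum_le_sum fun j _ => ?_
  have hc : 0 ≤ c i j := Complex.normSq_nonneg _
  have := mul_le_mul_of_nonneg_right
    (mul_le_mul_log_add_exp_sub (hρ.eigenvalues_nonneg i) (hX.eigenvalues j)) hc
  nlinarith

end Gibbs

/-! ### Embeddings of local operators, duality with partial traces, and the form of the Petz maps.
-/

section Amplification

variable {m n : Type*} [Fintype m] [DecidableEq m] [Fintype n] [DecidableEq n]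

open scoped Kronecker

/-- Lets the exponential of an amplified operator be computed on the small system. -/
theorem algHom_exp (f : Matrix m m ℂ →ₐ[ℂ] Matrix n n ℂ) (X : Matrix m m ℂ) :
    f (NormedSpace.exp X) = NormedSpace.exp (f X) := by
  open scoped Matrix.Norms.L2Operator in
  have : NormedAlgebra ℚ (Matrix m m ℂ) := NormedAlgebra.restrictScalars ℚ ℂ _
  open scoped Matrix.Norms.L2Operator in
  exact NormedSpace.map_exp f f.toLinearMap.continuous_of_finiteDimensional X

/-- The embedding `Y ↦ 1 ⊗ Y`. -/
def ampLeft (A : Type*) [Fintype A] [DecidableEq A] :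
    Matrix m m ℂ →ₐ[ℂ] Matrix (A × m) (A × m) ℂ :=
  AlgHom.ofLinearMap
    { toFun := fun Y => (1 : Matrix A A ℂ) ⊗ₖ Y
      map_add' := fun X Y => kronecker_add _ X Y
      map_smul' := fun c X => kronecker_smul c _ X }
    one_kronecker_one
    fun X Y => by
      change (1 : Matrix A A ℂ) ⊗ₖ (X * Y) = ((1 : Matrix A A ℂ) ⊗ₖ X) * ((1 : Matrix A A ℂ) ⊗ₖ Y)
      rw [← mul_kronecker_mul, Matrix.one_mul]

/-- The embedding `Y ↦ Y ⊗ 1`. -/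
def ampRight (C : Type*) [Fintype C] [DecidableEq C] :
    Matrix m m ℂ →ₐ[ℂ] Matrix (m × C) (m × C) ℂ :=
  AlgHom.ofLinearMap
    { toFun := fun Y => Y ⊗ₖ (1 : Matrix C C ℂ)
      map_add' := fun X Y => add_kronecker X Y _
      map_smul' := fun c X => smul_kronecker c X _ }
    one_kronecker_one
    fun X Y => by
      change (X * Y) ⊗ₖ (1 : Matrix C C ℂ) = (X ⊗ₖ (1 : Matrix C C ℂ)) * (Y ⊗ₖ (1 : Matrix C C ℂ))
      rw [← mul_kronecker_mul, Matrix.one_mul]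

variable {A B C : Type*} [Fintype A] [DecidableEq A] [Fintype B] [DecidableEq B]
  [Fintype C] [DecidableEq C]

theorem ampLeft_apply (Y : Matrix m m ℂ) (i j : A × m) :
    ampLeft A Y i j = if i.1 = j.1 then Y i.2 j.2 else 0 := by
  change (1 : Matrix A A ℂ) i.1 j.1 * Y i.2 j.2 = _
  rw [one_apply]; split_ifs <;> simp

theorem ampRight_apply (Y : Matrix m m ℂ) (i j : m × C) :
    ampRight C Y i j = if i.2 = j.2 then Y i.1 j.1 else 0 := by
  change Y i.1 j.1 * (1 : Matrix C C ℂ) i.2 j.2 = _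
  rw [one_apply]; split_ifs <;> simp

theorem ampLeft_conjTranspose (Y : Matrix m m ℂ) : (ampLeft A Y)ᴴ = ampLeft A Yᴴ := by
  ext i j
  simp only [conjTranspose_apply, ampLeft_apply, eq_comm (a := j.1)]
  split_ifs <;> simp

theorem ampRight_conjTranspose (Y : Matrix m m ℂ) : (ampRight C Y)ᴴ = ampRight C Yᴴ := by
  ext i j
  simp only [conjTranspose_apply, ampRight_apply, eq_comm (a := j.2)]
  split_ifs <;> simp

/-- The embedding `Y ↦ Y ⊗ 1_C` of operators on `A ⊗ B` into operators on `A ⊗ (B ⊗ C)`. -/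
def ampAB (A B C : Type*) [Fintype A] [DecidableEq A] [Fintype B] [DecidableEq B]
    [Fintype C] [DecidableEq C] :
    Matrix (A × B) (A × B) ℂ →ₐ[ℂ] Matrix (A × B × C) (A × B × C) ℂ :=
  (reindexAlgEquiv ℂ ℂ (Equiv.prodAssoc A B C)).toAlgHom.comp (ampRight C)

theorem ampAB_apply (Y : Matrix (A × B) (A × B) ℂ) (i j : A × B × C) :
    ampAB A B C Y i j = if i.2.2 = j.2.2 then Y (i.1, i.2.1) (j.1, j.2.1) else 0 :=
  ampRight_apply Y ((i.1, i.2.1), i.2.2) ((j.1, j.2.1), j.2.2)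

theorem ampAB_conjTranspose (Y : Matrix (A × B) (A × B) ℂ) :
    (ampAB A B C Y)ᴴ = ampAB A B C Yᴴ := by
  ext i j
  simp only [conjTranspose_apply, ampAB_apply, eq_comm (a := j.2.2)]
  split_ifs <;> simp

theorem ampAB_ampLeft (Y : Matrix B B ℂ) :
    ampAB A B C (ampLeft A Y) = ampLeft A (ampRight C Y) := by
  ext i j
  simp only [ampAB_apply, ampLeft_apply, ampRight_apply]
  split_ifs <;> rfl

/-- Amplification is dual to the partial trace. With its variants below, this turns `tr ρX` into
entropies of marginals. -/
theorem trace_mul_ampLeft (ρ : Matrix (A × m) (A × m) ℂ) (Y : Matrix m m ℂ) :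
    (ρ * ampLeft A Y).trace = (traceLeft A m ρ * Y).trace := by
  simp only [trace, diag, mul_apply, ampLeft_apply, Fintype.sum_prod_type, traceLeft,
    LinearMap.coe_mk, AddHom.coe_mk, of_apply, Finset.sum_mul, mul_ite, mul_zero]
  simp only [Finset.sum_ite_irrel, Finset.sum_const_zero, Finset.sum_ite_eq', Finset.mem_univ,
    if_true]
  rw [Finset.sum_comm]
  refine Finset.sum_congr rfl fun i _ => Finset.sum_comm

theorem trace_mul_ampAB (ρ : Matrix (A × B × C) (A × B × C) ℂ) (Y : Matrix (A × B) (A × B) ℂ) :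
    (ρ * ampAB A B C Y).trace = (idTensor A (traceRight B C) ρ * Y).trace := by
  simp only [trace, diag, mul_apply, ampAB_apply, Fintype.sum_prod_type, traceRight, idTensor,
    LinearMap.coe_mk, AddHom.coe_mk, of_apply, Finset.sum_mul, mul_ite, mul_zero,
    Finset.sum_ite_eq', Finset.mem_univ, if_true]
  refine Finset.sum_congr rfl fun a _ => Finset.sum_congr rfl fun b _ => ?_
  rw [Finset.sum_comm]
  refine Finset.sum_congr rfl fun a' _ => Finset.sum_comm

theorem traceLeft_idTensor_traceRight (ρ : Matrix (A × B × C) (A × B × C) ℂ) :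
    traceLeft A B (idTensor A (traceRight B C) ρ) = traceRight B C (traceLeft A (B × C) ρ) := by
  ext i j
  simp only [traceLeft, traceRight, idTensor, LinearMap.coe_mk, AddHom.coe_mk, of_apply]
  exact Finset.sum_comm

theorem trace_mul_ampLeft_ampRight (ρ : Matrix (A × B × C) (A × B × C) ℂ) (Y : Matrix B B ℂ) :
    (ρ * ampLeft A (ampRight C Y)).trace =
      (traceRight B C (traceLeft A (B × C) ρ) * Y).trace := by
  rw [← ampAB_ampLeft, trace_mul_ampAB, trace_mul_ampLeft, traceLeft_idTensor_traceRight]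

theorem idTensor_comp {k : Type*} [Fintype k] [DecidableEq k] (S : Matrix n n ℂ →ₗ[ℂ] Matrix k k ℂ)
    (T : Matrix m m ℂ →ₗ[ℂ] Matrix n n ℂ) (X : Matrix (A × m) (A × m) ℂ) :
    idTensor A (S ∘ₗ T) X = idTensor A S (idTensor A T X) := rfl

theorem idTensor_conjMap (V : Matrix m m ℂ) (X : Matrix (A × m) (A × m) ℂ) :
    idTensor A (conjMap V) X = ampLeft A V * X * (ampLeft A V)ᴴ := by
  ext i j
  rw [ampLeft_conjTranspose]
  simp only [idTensor, conjMap, LinearMap.coe_mk, AddHom.coe_mk, of_apply, mul_apply,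
    ampLeft_apply, Fintype.sum_prod_type, ite_mul, zero_mul, mul_ite, mul_zero]
  simp [Finset.sum_ite_irrel]

theorem hsAdjoint_traceRight (Y : Matrix B B ℂ) :
    hsAdjoint (traceRight B C) Y = ampRight C Y := by
  ext i j
  have h : traceRight B C (single i j 1) = if i.2 = j.2 then single i.1 j.1 1 else 0 := by
    ext x y
    simp only [traceRight, LinearMap.coe_mk, AddHom.coe_mk, of_apply, single_apply, Prod.ext_iff]
    split_ifs with h
    · rw [Finset.sum_eq_single i.2]
      · simp [single_apply, h]
      · intro b _ hb
        simp [hb.symm]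
      · simp
    · refine Finset.sum_eq_zero fun c _ => ?_
      rw [if_neg]
      rintro ⟨⟨-, h1⟩, -, h2⟩
      exact h (h1.trans h2.symm)
  simp only [hsAdjoint, LinearMap.coe_mk, AddHom.coe_mk, of_apply, h, ampRight_apply]
  split_ifs with hij
  · rw [conjTranspose_single, star_one, trace_mul_comm]
    simp [trace_mul_single]
  · simp

theorem idTensor_hsAdjoint_traceRight (X : Matrix (A × B) (A × B) ℂ) :
    idTensor A (hsAdjoint (traceRight B C)) X = ampAB A B C X := by
  ext i j
  simp only [idTensor, hsAdjoint_traceRight, LinearMap.coe_mk, AddHom.coe_mk, of_apply,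
    ampAB_apply, ampRight_apply]

/-- Conjugation of `M ⊗ 1_C` with `1_A ⊗ K`. -/
def sandwich (K : Matrix (B × C) (B × C) ℂ) (M : Matrix (A × B) (A × B) ℂ) :
    Matrix (A × B × C) (A × B × C) ℂ :=
  ampLeft A K * ampAB A B C M * (ampLeft A K)ᴴ

theorem idTensor_rotatedPetz (σ : Matrix (B × C) (B × C) ℂ) (φ ϑ : ℝ → ℝ)
    (M : Matrix (A × B) (A × B) ℂ) :
    idTensor A (rotatedPetz σ (traceRight B C) φ ϑ) M =
      sandwich (phaseUnitary σ ϑ * cfc Real.sqrt σ)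
        (ampLeft A (invSqrt (traceRight B C σ) * phaseUnitary (traceRight B C σ) φ) * M *
          (ampLeft A (invSqrt (traceRight B C σ) * phaseUnitary (traceRight B C σ) φ))ᴴ) := by
  unfold rotatedPetz sandwich
  simp only [idTensor_comp, idTensor_conjMap, idTensor_hsAdjoint_traceRight, map_mul,
    conjTranspose_mul, Matrix.mul_assoc]

theorem continuous_ampLeft : Continuous (ampLeft A : Matrix m m ℂ →ₐ[ℂ] _) :=
  (ampLeft A : Matrix m m ℂ →ₐ[ℂ] _).toLinearMap.continuous_of_finiteDimensional

theorem continuous_ampAB : Continuous (ampAB A B C) :=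
  (ampAB A B C).toLinearMap.continuous_of_finiteDimensional

theorem tendsto_sandwich {ι : Type*} {l : Filter ι} {K : ι → Matrix (B × C) (B × C) ℂ}
    {M : ι → Matrix (A × B) (A × B) ℂ} {K₀ : Matrix (B × C) (B × C) ℂ}
    {M₀ : Matrix (A × B) (A × B) ℂ} (hK : Tendsto K l (𝓝 K₀)) (hM : Tendsto M l (𝓝 M₀)) :
    Tendsto (fun i => sandwich (K i) (M i)) l (𝓝 (sandwich K₀ M₀)) := by
  have h1 := (continuous_ampLeft (A := A)).tendsto K₀ |>.comp hK
  have h2 := (continuous_ampAB (A := A) (B := B) (C := C)).tendsto M₀ |>.comp hM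
  exact (h1.mul h2).mul ((continuous_id.matrix_conjTranspose.tendsto _).comp h1)

end Amplification

/-! ### Golden–Thompson with regularised marginals. -/

section Regularized

open scoped ComplexOrder

theorem exists_mem_Icc_exp_I_mul (s : ℝ) : ∃ r ∈ Set.Icc 0 (2 * Real.pi),
    Complex.exp (Complex.I * r) = Complex.exp (Complex.I * s) := by
  have hp : 0 < 2 * Real.pi := by positivity
  refine ⟨toIcoMod hp 0 s, ?_, ?_⟩
  · have := toIcoMod_mem_Ico hp 0 s
    exact ⟨this.1, by linarith [this.2]⟩
  · refine Complex.exp_eq_exp_iff_exists_int.2 ⟨-toIcoDiv hp 0 s, ?_⟩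
    rw [toIcoMod]
    simp only [zsmul_eq_mul]
    push_cast
    ring

theorem exp_half_mul_eq {z : ℂ} (hz : z.re = 1) (s : ℝ) :
    Complex.exp (z / 2 * s) =
      ((√(Real.exp s) : ℝ) : ℂ) * Complex.exp (Complex.I * ((z.im / 2 * s : ℝ) : ℂ)) := by
  rw [← Real.exp_half, Complex.ofReal_exp, ← Complex.exp_add]
  congr 1
  apply Complex.ext <;> simp [hz]
  ring

variable {A B C : Type*} [Fintype A] [DecidableEq A] [Fintype B] [DecidableEq B]
  [Fintype C] [DecidableEq C]

theorem posSemidef_traceLeft {m : Type*} [Fintype m] {ρ : Matrix (A × m) (A × m) ℂ}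
    (h : ρ.PosSemidef) : (traceLeft A m ρ).PosSemidef := by
  have : traceLeft A m ρ = ∑ a, ρ.submatrix (fun x => (a, x)) (fun x => (a, x)) := by
    ext i j
    simp [traceLeft, Matrix.sum_apply]
  rw [this]
  exact posSemidef_sum _ fun a _ => h.submatrix _

theorem posSemidef_idTensor_traceRight {ρ : Matrix (A × B × C) (A × B × C) ℂ}
    (h : ρ.PosSemidef) : (idTensor A (traceRight B C) ρ).PosSemidef := by
  have : idTensor A (traceRight B C) ρ =
      ∑ c, ρ.submatrix (fun x => (x.1, x.2, c)) (fun x => (x.1, x.2, c)) := by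
    ext i j
    simp [traceRight, idTensor, Matrix.sum_apply]
  rw [this]
  exact posSemidef_sum _ fun a _ => h.submatrix _

theorem IsHermitian.ampLeft {m : Type*} [Fintype m] [DecidableEq m] {Y : Matrix m m ℂ}
    (h : Y.IsHermitian) : (ampLeft A Y).IsHermitian := by
  rw [Matrix.IsHermitian, ampLeft_conjTranspose, h.eq]

theorem IsHermitian.ampRight {m : Type*} [Fintype m] [DecidableEq m] {Y : Matrix m m ℂ}
    (h : Y.IsHermitian) : (ampRight C Y).IsHermitian := by
  rw [Matrix.IsHermitian, ampRight_conjTranspose, h.eq]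

theorem IsHermitian.ampAB {Y : Matrix (A × B) (A × B) ℂ}
    (h : Y.IsHermitian) : (ampAB A B C Y).IsHermitian := by
  rw [Matrix.IsHermitian, ampAB_conjTranspose, h.eq]

/-- The rotated factor `√(x + ε) exp (i ϑ x)`. -/
def rotSqrt (ε : ℝ) (ϑ : ℝ → ℝ) (x : ℝ) : ℂ :=
  ((√(x + ε) : ℝ) : ℂ) * Complex.exp (Complex.I * ϑ x)

/-- The rotated factor `(x + ε) ^ (-1/2) exp (i φ x)`. -/
def rotInvSqrt (ε : ℝ) (φ : ℝ → ℝ) (x : ℝ) : ℂ :=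
  (((√(x + ε))⁻¹ : ℝ) : ℂ) * Complex.exp (Complex.I * φ x)

/-- Adding `ε` to the spectra makes all logarithms genuine. The shift `ε ^ 2` for `μ` is of smaller
order so that it still vanishes in the limit after conjugation by `(τ + ε)^{-1/2}`. -/
theorem exists_re_trace_exp_le {σ : Matrix (B × C) (B × C) ℂ} {τ : Matrix B B ℂ}
    {μ : Matrix (A × B) (A × B) ℂ} {ω : Matrix (A × B × C) (A × B × C) ℂ}
    (hσ : σ.PosSemidef) (hτ : τ.PosSemidef) (hμ : μ.PosSemidef) (hω : ω.PosDef)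
    {ε : ℝ} (hε : 0 < ε) :
    ∃ φ ϑ : ℝ → ℝ, (∀ x, φ x ∈ Set.Icc 0 (2 * Real.pi)) ∧ (∀ x, ϑ x ∈ Set.Icc 0 (2 * Real.pi)) ∧
      (NormedSpace.exp (cfc Real.log ω + ampLeft A (cfc (fun x => Real.log (x + ε)) σ) +
        ampLeft A (ampRight C (cfc (fun x => -Real.log (x + ε)) τ)) +
        ampAB A B C (cfc (fun x => Real.log (x + ε ^ 2)) μ))).trace.re ≤
      (ω * sandwich (spectralMap hσ.1 (rotSqrt ε ϑ))
        (ampLeft A (spectralMap hτ.1 (rotInvSqrt ε φ)) * (μ + (ε ^ 2 : ℂ) • 1) *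
          (ampLeft A (spectralMap hτ.1 (rotInvSqrt ε φ)))ᴴ)).trace.re + ε := by
  set w := cfc Real.log ω with hw
  set k := ampLeft A (cfc (fun x => Real.log (x + ε)) σ) with hk
  set b := ampLeft A (ampRight C (cfc (fun x => -Real.log (x + ε)) τ)) with hb
  set l := ampAB A B C (cfc (fun x => Real.log (x + ε ^ 2)) μ) with hl
  set T := (NormedSpace.exp (w + k + b + l)).trace.re with hT
  have hwh : w.IsHermitian := isHermitian_cfc _ _
  have hlh : l.IsHermitian := IsHermitian.ampAB (isHermitian_cfc _ _)
  obtain ⟨z, hz, hzT⟩ : ∃ z : ℂ, z.re = 1 ∧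
      T - ε < ((expProd w k b l z)ᴴ * expProd w k b l z).trace.re := by
    -- The vertical line is not compact and the supremum may not be attained, hence the slack `ε`.
    by_contra! hcon
    have := re_trace_exp_add_le hwh (IsHermitian.ampLeft (isHermitian_cfc _ _))
      (IsHermitian.ampLeft (IsHermitian.ampRight (isHermitian_cfc _ _)))
      hlh hcon
    change T ≤ T - ε at this
    linarith
  choose red hred hred' using exists_mem_Icc_exp_I_mul
  -- The angles are the phases of the powers `(x + ε) ^ (± z / 2)`, reduced modulo `2π`.
  refine ⟨fun x => red (z.im / 2 * (-Real.log (x + ε))), fun x => red (z.im / 2 * Real.log (x + ε)),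
    fun x => hred _, fun x => hred _, ?_⟩
  set φ : ℝ → ℝ := fun x => red (z.im / 2 * (-Real.log (x + ε))) with hφ
  set ϑ : ℝ → ℝ := fun x => red (z.im / 2 * Real.log (x + ε)) with hϑ
  have ek : NormedSpace.exp ((z / 2) • k) = ampLeft A (spectralMap hσ.1 (rotSqrt ε ϑ)) := by
    rw [hk, ← map_smul, ← algHom_exp, exp_smul_cfc hσ.1]
    congr 1
    refine spectralMap_congr _ fun i => ?_
    have hpos : 0 < hσ.1.eigenvalues i + ε := by linarith [hσ.eigenvalues_nonneg i]
    rw [exp_half_mul_eq hz, rotSqrt, hϑ, hred', Real.exp_log hpos]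
  have eb : NormedSpace.exp ((z / 2) • b) =
      ampAB A B C (ampLeft A (spectralMap hτ.1 (rotInvSqrt ε φ))) := by
    rw [hb, ← map_smul, ← map_smul, ← algHom_exp, ← algHom_exp, exp_smul_cfc hτ.1, ampAB_ampLeft]
    congr 2
    refine spectralMap_congr _ fun i => ?_
    have hpos : 0 < hτ.1.eigenvalues i + ε := by linarith [hτ.eigenvalues_nonneg i]
    rw [exp_half_mul_eq hz, rotInvSqrt, hφ, hred', Real.exp_neg, Real.exp_log hpos, Real.sqrt_inv]
  -- For this reason the imaginary powers of the outer factors `w` and `l` cancel against their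
  -- adjoints.
  have hzz : z / 2 + star (z / 2) = 1 := by
    apply Complex.ext
    · simp [hz]; norm_num
    · simp; ring
  have el : NormedSpace.exp ((z / 2) • l) * (NormedSpace.exp ((z / 2) • l))ᴴ =
      ampAB A B C (μ + (ε ^ 2 : ℂ) • 1) := by
    rw [exp_smul_conjTranspose hlh, ← exp_add_smul, hzz, hl, ← map_smul, ← algHom_exp,
      exp_smul_cfc hμ.1]
    congr 1
    conv_rhs => rw [← spectralMap_const_one hμ.1, spectralMap_smul]; arg 1; rw [eq_spectralMap_id hμ.1]
    rw [spectralMap_add]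
    refine spectralMap_congr _ fun i => ?_
    have hpos : 0 < hμ.1.eigenvalues i + ε ^ 2 := by
      have := hμ.eigenvalues_nonneg i
      positivity
    rw [one_mul, ← Complex.ofReal_exp, Real.exp_log hpos]
    push_cast
    ring
  have ew : (NormedSpace.exp ((z / 2) • w))ᴴ * NormedSpace.exp ((z / 2) • w) = ω := by
    rw [exp_smul_conjTranspose hwh, ← exp_add_smul, add_comm, hzz, one_smul, hw, exp_cfc_log hω]
  have key : ((expProd w k b l z)ᴴ * expProd w k b l z).trace =
      (ω * sandwich (spectralMap hσ.1 (rotSqrt ε ϑ))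
        (ampLeft A (spectralMap hτ.1 (rotInvSqrt ε φ)) * (μ + (ε ^ 2 : ℂ) • 1) *
          (ampLeft A (spectralMap hτ.1 (rotInvSqrt ε φ)))ᴴ)).trace := by
    rw [trace_mul_comm, sandwich, map_mul, map_mul, ← ampAB_conjTranspose, ← eb, ← ek, ← el, ← ew,
      expProd]
    simp only [conjTranspose_mul, Matrix.mul_assoc]
    conv_rhs => rw [trace_mul_comm]
    simp only [Matrix.mul_assoc]
  rw [← key]
  linarith

/-- Operators on `B` annihilated by the marginal on `B` are annihilated by the joint state. -/
theorem ampLeft_mul_eq_zero {m : Type*} [Fintype m] [DecidableEq m]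
    {M : Matrix (A × m) (A × m) ℂ} (hM : M.PosSemidef)
    {Z : Matrix m m ℂ} (hZ : Z * traceLeft A m M = 0) : ampLeft A Z * M = 0 := by
  obtain ⟨Y, hY⟩ : ∃ Y : Matrix (A × m) (A × m) ℂ, M = Y * Yᴴ := by
    refine ⟨cfc Real.sqrt M, ?_⟩
    rw [(isHermitian_cfc _ _).eq, cfc_sqrt_mul_self hM]
  -- By duality this trace is that of `Z * traceLeft A m M * Zᴴ`.
  have h1 : (ampLeft A Z * Y * (ampLeft A Z * Y)ᴴ).trace = 0 := by
    rw [conjTranspose_mul, Matrix.mul_assoc, ← Matrix.mul_assoc Y, ← hY, trace_mul_comm,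
      Matrix.mul_assoc, ampLeft_conjTranspose, ← map_mul, trace_mul_ampLeft, trace_mul_comm,
      Matrix.mul_assoc, hZ, Matrix.mul_zero, trace_zero]
  have h2 := trace_mul_conjTranspose_self_eq_zero_iff.1 h1
  rw [hY, ← Matrix.mul_assoc, h2, Matrix.zero_mul]

/-- The kernel of the marginal does not see `M`, so a function that blows up at `0` as `ε → 0` may
be replaced by `0` there. -/
theorem spectralMap_ampLeft_mul {m : Type*} [Fintype m] [DecidableEq m]
    {M : Matrix (A × m) (A × m) ℂ} (hM : M.PosSemidef) {f g : ℝ → ℂ}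
    (hfg : ∀ x, x ≠ 0 → f x = g x) :
    ampLeft A (spectralMap (posSemidef_traceLeft hM).1 f) * M =
      ampLeft A (spectralMap (posSemidef_traceLeft hM).1 g) * M := by
  set h := (posSemidef_traceLeft hM).1
  have e : spectralMap h f = spectralMap h g + spectralMap h (fun x => f x - g x) := by
    rw [spectralMap_add]
    exact spectralMap_congr _ fun i => by ring
  rw [e, map_add, Matrix.add_mul, ampLeft_mul_eq_zero (Z := spectralMap h fun x => f x - g x) hM,
    add_zero]
  have e2 : spectralMap h (fun x => f x - g x) * traceLeft A m M =
      spectralMap h (fun x => f x - g x) * spectralMap h (fun x => (x : ℂ)) :=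
    congrArg _ (eq_spectralMap_id h)
  rw [e2, spectralMap_mul]
  have : spectralMap h (fun _ => 0) = 0 := by
    have := spectralMap_smul h 0 (fun _ => 1)
    simpa using this.symm
  rw [← this]
  refine spectralMap_congr _ fun i => ?_
  by_cases hi : h.eigenvalues i = 0
  · simp [hi]
  · simp [hfg _ hi]

end Regularized

/-! ### Removing the regularisation. -/

section Limit

open scoped ComplexOrder

theorem re_trace_mul_cfc {m : Type*} [Fintype m] [DecidableEq m] {M : Matrix m m ℂ}
    (hM : M.IsHermitian) (f : ℝ → ℝ) :
    (M * cfc f M).trace.re = ∑ i, hM.eigenvalues i * f (hM.eigenvalues i) := by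
  have e : M * cfc f M = spectralMap hM (fun x => (x : ℂ)) * spectralMap hM (fun x => (f x : ℂ)) :=
    congrArg₂ _ (eq_spectralMap_id hM) (cfc_eq_spectralMap hM f)
  rw [e, spectralMap_mul, trace_spectralMap, Complex.re_sum]
  simp

/-- A zero eigenvalue contributes exactly `0` for every `ε`, as its logarithm is multiplied by `0`;
elsewhere `log` is continuous. -/
theorem tendsto_re_trace_mul_log {ι : Type*} {l : Filter ι} {m : Type*} [Fintype m] [DecidableEq m]
    {M : Matrix m m ℂ} (hM : M.IsHermitian) {ε : ι → ℝ} (hε : Tendsto ε l (𝓝 0)) :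
    Tendsto (fun n => (M * cfc (fun x => Real.log (x + ε n)) M).trace.re) l
      (𝓝 (-entropy M)) := by
  simp_rw [entropy, neg_neg, re_trace_mul_cfc hM]
  refine tendsto_finsetSum _ fun i _ => ?_
  by_cases hi : hM.eigenvalues i = 0
  · simpa [hi] using tendsto_const_nhds
  · refine Tendsto.const_mul _ ((Real.continuousAt_log hi).tendsto.comp ?_)
    simpa using hε.const_add (hM.eigenvalues i)

theorem norm_exp_I_mul (x : ℝ) : ‖Complex.exp (Complex.I * x)‖ = 1 := by
  rw [mul_comm, Complex.norm_exp_ofReal_mul_I]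

variable {A B C : Type*} [Fintype A] [DecidableEq A] [Fintype B] [DecidableEq B]
  [Fintype C] [DecidableEq C]

theorem tendsto_rotSqrt {ι : Type*} {l : Filter ι} {ε : ι → ℝ} (hε : Tendsto ε l (𝓝 0))
    {ϑ : ι → ℝ → ℝ} {ϑ₀ : ℝ → ℝ} (hϑ : Tendsto ϑ l (𝓝 ϑ₀)) (x : ℝ) :
    Tendsto (fun n => rotSqrt (ε n) (ϑ n) x) l (𝓝 (rotSqrt 0 ϑ₀ x)) := by
  have hx := tendsto_pi_nhds.1 hϑ x
  refine Tendsto.mul ?_ ?_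
  · exact ((Complex.continuous_ofReal.comp Real.continuous_sqrt).tendsto _).comp
      (tendsto_const_nhds.add hε)
  · exact (Complex.continuous_exp.tendsto _).comp
      (((Complex.continuous_ofReal.tendsto _).comp hx).const_mul _)

theorem tendsto_rotInvSqrt {ι : Type*} {l : Filter ι} {ε : ι → ℝ} (hε : Tendsto ε l (𝓝 0))
    {φ : ι → ℝ → ℝ} {φ₀ : ℝ → ℝ} (hφ : Tendsto φ l (𝓝 φ₀)) {x : ℝ} (hx0 : 0 < x) :
    Tendsto (fun n => rotInvSqrt (ε n) (φ n) x) l (𝓝 (rotInvSqrt 0 φ₀ x)) := by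
  have hx := tendsto_pi_nhds.1 hφ x
  refine Tendsto.mul ?_ ?_
  · refine (Complex.continuous_ofReal.tendsto _).comp (Tendsto.inv₀ ?_ ?_)
    · exact (Real.continuous_sqrt.tendsto _).comp (tendsto_const_nhds.add hε)
    · rw [add_zero]; exact (Real.sqrt_pos.2 hx0).ne'
  · exact (Complex.continuous_exp.tendsto _).comp
      (((Complex.continuous_ofReal.tendsto _).comp hx).const_mul _)

theorem norm_sq_mul_rotInvSqrt_le {ε : ℝ} (hε : 0 < ε) (φ : ℝ → ℝ) {x : ℝ} (hx : 0 ≤ x) :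
    ‖(ε ^ 2 : ℂ) * (rotInvSqrt ε φ x * star (rotInvSqrt ε φ x))‖ ≤ ε := by
  have hp : 0 < x + ε := by linarith
  have e : ‖(ε ^ 2 : ℂ) * (rotInvSqrt ε φ x * star (rotInvSqrt ε φ x))‖ = ε ^ 2 * (x + ε)⁻¹ := by
    rw [norm_mul, norm_mul, norm_star, rotInvSqrt, norm_mul, norm_exp_I_mul, mul_one, norm_pow,
      Complex.norm_real, Complex.norm_real, norm_inv, ← mul_inv, Real.norm_of_nonneg hε.le,
      Real.norm_of_nonneg (Real.sqrt_nonneg _), Real.mul_self_sqrt hp.le]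
  rw [e, ← div_eq_mul_inv, div_le_iff₀ hp]
  nlinarith

/-- On the `μ` part the zero eigenvalues of the marginal are irrelevant, and the `ε ^ 2` part has
eigenvalues `ε ^ 2 / (x + ε) ≤ ε`. -/
theorem tendsto_conj_rotInvSqrt {ι : Type*} {l : Filter ι} {ε : ι → ℝ} (hε : Tendsto ε l (𝓝 0))
    (hε0 : ∀ n, 0 < ε n) {φ : ι → ℝ → ℝ} {φ₀ : ℝ → ℝ} (hφ : Tendsto φ l (𝓝 φ₀))
    {μ : Matrix (A × B) (A × B) ℂ} (hμ : μ.PosSemidef) :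
    Tendsto (fun n => ampLeft A (spectralMap (posSemidef_traceLeft hμ).1 (rotInvSqrt (ε n) (φ n))) *
      (μ + (ε n ^ 2 : ℂ) • 1) *
      (ampLeft A (spectralMap (posSemidef_traceLeft hμ).1 (rotInvSqrt (ε n) (φ n))))ᴴ) l
      (𝓝 (ampLeft A (spectralMap (posSemidef_traceLeft hμ).1 (rotInvSqrt 0 φ₀)) * μ *
      (ampLeft A (spectralMap (posSemidef_traceLeft hμ).1 (rotInvSqrt 0 φ₀)))ᴴ)) := by
  set hτ := posSemidef_traceLeft hμ
  set g : ι → ℝ → ℂ := fun n x => if x = 0 then 0 else rotInvSqrt (ε n) (φ n) x with hg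
  have hsplit : ∀ n, ampLeft A (spectralMap hτ.1 (rotInvSqrt (ε n) (φ n))) *
      (μ + (ε n ^ 2 : ℂ) • 1) * (ampLeft A (spectralMap hτ.1 (rotInvSqrt (ε n) (φ n))))ᴴ =
      ampLeft A (spectralMap hτ.1 (g n)) * μ * (ampLeft A (spectralMap hτ.1 (g n)))ᴴ +
        ampLeft A (spectralMap hτ.1 (fun x => (ε n ^ 2 : ℂ) *
          (rotInvSqrt (ε n) (φ n) x * star (rotInvSqrt (ε n) (φ n) x)))) := by
    intro n
    have h1 : ampLeft A (spectralMap hτ.1 (rotInvSqrt (ε n) (φ n))) * μ =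
        ampLeft A (spectralMap hτ.1 (g n)) * μ :=
      spectralMap_ampLeft_mul hμ fun x hx => by simp [hg, hx]
    have h2 : μ * (ampLeft A (spectralMap hτ.1 (rotInvSqrt (ε n) (φ n))))ᴴ =
        μ * (ampLeft A (spectralMap hτ.1 (g n)))ᴴ := by
      have := congrArg conjTranspose h1
      rwa [conjTranspose_mul, conjTranspose_mul, hμ.1.eq] at this
    rw [Matrix.mul_add, Matrix.add_mul, h1, Matrix.mul_assoc, h2, ← Matrix.mul_assoc]
    refine congrArg₂ (· + ·) rfl ?_
    rw [Matrix.mul_smul, Matrix.mul_one, Matrix.smul_mul, ampLeft_conjTranspose, ← map_mul,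
      spectralMap_conjTranspose, spectralMap_mul, ← map_smul, spectralMap_smul]
  simp_rw [hsplit]
  have hgt : Tendsto (fun n => ampLeft A (spectralMap hτ.1 (g n))) l
      (𝓝 (ampLeft A (spectralMap hτ.1 (rotInvSqrt 0 φ₀)))) := by
    refine (continuous_ampLeft.tendsto _).comp (tendsto_spectralMap _ fun i => ?_)
    -- The limit also vanishes at `0`, since `(√0)⁻¹ = 0`.
    by_cases hi : hτ.1.eigenvalues i = 0
    · simpa [hg, hi, rotInvSqrt] using tendsto_const_nhds
    · simp only [hg, if_neg hi]
      exact tendsto_rotInvSqrt hε hφ (lt_of_le_of_ne (hτ.eigenvalues_nonneg i) (Ne.symm hi))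
  have h0 : spectralMap hτ.1 (fun _ => 0) = 0 := by
    simpa using (spectralMap_smul hτ.1 0 (fun _ => 1)).symm
  have hzt : Tendsto (fun n => ampLeft A (spectralMap hτ.1 (fun x => (ε n ^ 2 : ℂ) *
          (rotInvSqrt (ε n) (φ n) x * star (rotInvSqrt (ε n) (φ n) x))))) l (𝓝 0) := by
    have : Tendsto (fun n => spectralMap hτ.1 (fun x => (ε n ^ 2 : ℂ) *
          (rotInvSqrt (ε n) (φ n) x * star (rotInvSqrt (ε n) (φ n) x)))) l (𝓝 0) := by
      rw [← h0]
      exact tendsto_spectralMap _ fun i => squeeze_zero_norm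
        (fun n => norm_sq_mul_rotInvSqrt_le (hε0 n) _ (hτ.eigenvalues_nonneg i)) hε
    have h := ((continuous_ampLeft (A := A)).tendsto 0).comp this
    rwa [map_zero] at h
  have := ((hgt.mul (tendsto_const_nhds (x := μ))).mul
    ((continuous_id.matrix_conjTranspose.tendsto _).comp hgt)).add hzt
  rw [add_zero] at this
  exact this

theorem invSqrt_mul_phaseUnitary {m : Type*} [Fintype m] [DecidableEq m] {M : Matrix m m ℂ}
    (hM : M.IsHermitian) (φ : ℝ → ℝ) :
    invSqrt M * phaseUnitary M φ = spectralMap hM (rotInvSqrt 0 φ) := by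
  rw [invSqrt, cfc_eq_spectralMap hM, phaseUnitary_eq_spectralMap hM, spectralMap_mul]
  refine spectralMap_congr _ fun i => ?_
  simp only [rotInvSqrt, add_zero]

theorem phaseUnitary_mul_sqrt {m : Type*} [Fintype m] [DecidableEq m] {M : Matrix m m ℂ}
    (hM : M.IsHermitian) (ϑ : ℝ → ℝ) :
    phaseUnitary M ϑ * cfc Real.sqrt M = spectralMap hM (rotSqrt 0 ϑ) := by
  rw [cfc_eq_spectralMap hM, phaseUnitary_eq_spectralMap hM, spectralMap_mul]
  refine spectralMap_congr _ fun i => ?_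
  simp only [rotSqrt, add_zero]
  ring

/-- The recoverability bound tested against a single positive definite operator `ω`. -/
theorem exists_rotatedPetz_le {ρ : Matrix (A × B × C) (A × B × C) ℂ} (hρ : IsDensity ρ)
    {ω : Matrix (A × B × C) (A × B × C) ℂ} (hω : ω.PosDef) :
    ∃ φ ϑ : ℝ → ℝ, (∀ x, φ x ∈ Set.Icc 0 (2 * Real.pi)) ∧ (∀ x, ϑ x ∈ Set.Icc 0 (2 * Real.pi)) ∧
      (ρ * cfc Real.log ω).trace.re + 1 -
        (ω * idTensor A (rotatedPetz (traceLeft A (B × C) ρ) (traceRight B C) φ ϑ)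
          (idTensor A (traceRight B C) ρ)).trace.re ≤ condMutualInfo ρ := by
  set σ := traceLeft A (B × C) ρ with hσ_def
  set μ := idTensor A (traceRight B C) ρ with hμ_def
  have hσ : σ.PosSemidef := posSemidef_traceLeft hρ.1
  have hμ : μ.PosSemidef := posSemidef_idTensor_traceRight hρ.1
  have hτ := posSemidef_traceLeft hμ
  have hτeq : traceRight B C σ = traceLeft A B μ := (traceLeft_idTensor_traceRight ρ).symm
  set ε : ℕ → ℝ := fun n => 1 / ((n : ℝ) + 1) with hε_def
  have hε0 : ∀ n, 0 < ε n := fun n => by positivity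
  choose φ ϑ hφ hϑ hle using fun n => exists_re_trace_exp_le hσ hτ hμ hω (hε0 n)
  -- Angles are functions on all of `ℝ`; the product of intervals is compact but not sequentially
  -- compact, so an ultrafilter replaces a convergent subsequence.
  let 𝒰 : Ultrafilter ℕ := hyperfilter ℕ
  have hε : Tendsto ε 𝒰 (𝓝 0) :=
    tendsto_one_div_add_atTop_nhds_zero_nat.mono_left Nat.hyperfilter_le_atTop
  have hcomp : IsCompact (Set.pi Set.univ fun _ : ℝ => Set.Icc (0 : ℝ) (2 * Real.pi)) :=
    isCompact_univ_pi fun _ => isCompact_Icc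
  obtain ⟨φ₀, hφ₀, hφt⟩ := hcomp.ultrafilter_le_nhds' (𝒰.map φ)
    (Ultrafilter.mem_map.2 (Eventually.of_forall fun n x _ => hφ n x))
  obtain ⟨ϑ₀, hϑ₀, hϑt⟩ := hcomp.ultrafilter_le_nhds' (𝒰.map ϑ)
    (Ultrafilter.mem_map.2 (Eventually.of_forall fun n x _ => hϑ n x))
  have hφt' : Tendsto φ 𝒰 (𝓝 φ₀) := hφt
  have hϑt' : Tendsto ϑ 𝒰 (𝓝 ϑ₀) := hϑt
  refine ⟨φ₀, ϑ₀, fun x => hφ₀ x trivial, fun x => hϑ₀ x trivial, ?_⟩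
  have hε2 : Tendsto (fun n => ε n ^ 2) 𝒰 (𝓝 0) := by simpa using hε.pow 2
  have lim1 := (((tendsto_re_trace_mul_log hσ.1 hε).sub (tendsto_re_trace_mul_log hτ.1 hε)).add
    (tendsto_re_trace_mul_log hμ.1 hε2)).const_add (ρ * cfc Real.log ω).trace.re
  have limS := tendsto_sandwich (tendsto_spectralMap hσ.1
    fun i => tendsto_rotSqrt hε hϑt' (hσ.1.eigenvalues i))
    (tendsto_conj_rotInvSqrt hε hε0 hφt' hμ)
  have lim2 := ((((Complex.continuous_re.comp (continuous_id.matrix_trace)).tendsto _).comp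
    (limS.const_mul ω)).add hε).const_add (-entropy ρ - 1)
  -- Gibbs gives a lower bound for `tr exp X` and the choice of angles an upper bound; the
  -- comparison survives the limit.
  have hineq := le_of_tendsto_of_tendsto' lim1 lim2 fun n => by
    have hG := re_trace_mul_le hρ.1 (X := cfc Real.log ω +
      ampLeft A (cfc (fun x => Real.log (x + ε n)) σ) +
        ampLeft A (ampRight C (cfc (fun x => -Real.log (x + ε n)) (traceLeft A B μ))) +
        ampAB A B C (cfc (fun x => Real.log (x + ε n ^ 2)) μ))
      ((((isHermitian_cfc _ _).add (IsHermitian.ampLeft (isHermitian_cfc _ _))).add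
        (IsHermitian.ampLeft (IsHermitian.ampRight (isHermitian_cfc _ _)))).add
        (IsHermitian.ampAB (isHermitian_cfc _ _)))
    simp only [Matrix.mul_add, trace_add, Complex.add_re] at hG
    rw [trace_mul_ampLeft, trace_mul_ampLeft_ampRight, trace_mul_ampAB, hρ.2, ← hσ_def, ← hμ_def,
      hτeq, cfc_neg, Matrix.mul_neg, trace_neg, Complex.neg_re] at hG
    have := hle n
    rw [cfc_neg] at this
    have hone : (1 : ℂ).re = 1 := rfl
    have hent : (ρ * cfc Real.log ρ).trace.re = -entropy ρ := by rw [entropy, neg_neg]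
    simp only [Function.comp, id]
    linarith
  rw [idTensor_rotatedPetz, hτeq, invSqrt_mul_phaseUnitary hτ.1, phaseUnitary_mul_sqrt hσ.1,
    condMutualInfo, ← hσ_def, ← hμ_def, hτeq]
  simp only [Function.comp, id] at hineq
  linarith

end Limit

/-! ### Compact convex hulls and the exchange of quantifiers. -/

section Minimax

/-- In a finite-dimensional space, the convex hull of a compact set is compact. -/
theorem isCompact_convexHull_of_finiteDimensional {E : Type*} [AddCommGroup E] [Module ℝ E]
    [TopologicalSpace E] [IsTopologicalAddGroup E] [ContinuousSMul ℝ E] [FiniteDimensional ℝ E]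
    {s : Set E} (hs : IsCompact s) : IsCompact (convexHull ℝ s) := by
  rcases s.eq_empty_or_nonempty with rfl | ⟨e₀, he₀⟩
  · simp
  set d := Module.finrank ℝ E + 1
  have himg : convexHull ℝ s = (fun p : (Fin d → ℝ) × (Fin d → E) => ∑ i, p.1 i • p.2 i) ''
      (stdSimplex ℝ (Fin d) ×ˢ Set.pi Set.univ fun _ => s) := by
    apply Set.Subset.antisymm
    · intro x hx
      obtain ⟨ι, _, z, w, hz, hind, hw, hw1, rfl⟩ := eq_pos_convex_span_of_mem_convexHull hx
      have hcard : Fintype.card ι ≤ Fintype.card (Fin d) := by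
        rw [Fintype.card_fin]
        exact hind.card_le_finrank_succ.trans
          (Nat.succ_le_succ (Submodule.finrank_le _))
      obtain ⟨e⟩ := Function.Embedding.nonempty_of_card_le hcard
      have hout : ∀ j ∉ Set.range e, Function.extend e w 0 j = 0 := fun j hj =>
        Function.extend_apply' _ _ _ (by simpa using hj)
      -- Carathéodory needs at most `d` points; shorter combinations are padded with weight `0` at
      -- `e₀`.
      refine ⟨(Function.extend e w 0, Function.extend e z fun _ => e₀), ⟨⟨fun j => ?_, ?_⟩, ?_⟩, ?_⟩
      · change 0 ≤ Function.extend e w 0 j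
        by_cases hj : j ∈ Set.range e
        · obtain ⟨i, rfl⟩ := hj
          rw [e.injective.extend_apply]
          exact (hw i).le
        · exact (hout j hj).ge
      · rw [← hw1]
        exact (Fintype.sum_of_injective e e.injective _ _ hout fun i => by
          rw [e.injective.extend_apply]).symm
      · intro j _
        change Function.extend e z (fun _ => e₀) j ∈ s
        by_cases hj : j ∈ Set.range e
        · obtain ⟨i, rfl⟩ := hj
          rw [e.injective.extend_apply]
          exact hz ⟨i, rfl⟩
        · rw [Function.extend_apply' _ _ _ (by simpa using hj)]
          exact he₀
      · exact (Fintype.sum_of_injective e e.injective _ _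
          (fun j hj => by simp only [hout j hj, zero_smul]) fun i => by
          simp only [e.injective.extend_apply]).symm
    · rintro _ ⟨⟨w, z⟩, ⟨⟨hw, hw1⟩, hz⟩, rfl⟩
      exact (convex_convexHull ℝ s).sum_mem (fun i _ => hw i) hw1
        fun i _ => subset_convexHull ℝ s (hz i trivial)
  rw [himg]
  refine ((isCompact_stdSimplex ℝ (Fin d)).prod (isCompact_univ_pi fun _ => hs)).image ?_
  fun_prop

open scoped ComplexOrder

variable {m : Type*} [Fintype m] [DecidableEq m]

theorem re_trace_mul_nonneg {X Y : Matrix m m ℂ} (hX : X.PosSemidef) (hY : Y.PosSemidef) :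
    0 ≤ (X * Y).trace.re := by
  have h := hY.mul_mul_conjTranspose_same (cfc Real.sqrt X)
  rw [← cfc_sqrt_mul_self hX, Matrix.mul_assoc, trace_mul_comm]
  rw [(isHermitian_cfc _ _).eq] at h
  exact (Complex.nonneg_iff.1 h.trace_nonneg).1

theorem convex_setOf_posDef : Convex ℝ {ω : Matrix m m ℂ | ω.PosDef} := by
  rw [convex_iff_forall_pos]
  intro x hx y hy a b ha hb _
  exact (PosDef.smul hx ha).add (PosDef.smul hy hb)

open scoped Matrix.Norms.L2Operator MatrixOrder in
-- Operator concavity of the logarithm, tested against a positive semidefinite `ρ`.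
theorem concaveOn_re_trace_mul_log {ρ : Matrix m m ℂ} (hρ : ρ.PosSemidef) :
    ConcaveOn ℝ {ω : Matrix m m ℂ | ω.PosDef} fun ω => (ρ * cfc Real.log ω).trace.re := by
  refine ⟨convex_setOf_posDef, fun x hx y hy a b ha hb hab => ?_⟩
  have h := (CFC.concaveOn_log (A := Matrix m m ℂ)).2
    (isStrictlyPositive_iff_posDef.2 hx) (isStrictlyPositive_iff_posDef.2 hy) ha hb hab
  have h' := re_trace_mul_nonneg hρ (Matrix.le_iff.1 h)
  rw [Matrix.mul_sub, trace_sub, Complex.sub_re, sub_nonneg, Matrix.mul_add, trace_add,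
    Matrix.mul_smul, Matrix.mul_smul, trace_smul, trace_smul, Complex.add_re] at h'
  simpa [CFC.log] using h'

open scoped Matrix.Norms.L2Operator MatrixOrder in
theorem continuousOn_re_trace_mul_log (ρ : Matrix m m ℂ) :
    ContinuousOn (fun ω : Matrix m m ℂ => (ρ * cfc Real.log ω).trace.re)
      {ω : Matrix m m ℂ | ω.PosDef} := by
  have h : ContinuousOn (fun ω : Matrix m m ℂ => cfc Real.log ω) {ω : Matrix m m ℂ | ω.PosDef} :=
    (CFC.continuousOn_log (A := Matrix m m ℂ)).mono
      fun x hx => ⟨hx.1, hx.isUnit⟩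
  have hc : Continuous fun X : Matrix m m ℂ => (ρ * X).trace.re :=
    Complex.continuous_re.comp (continuous_const.mul continuous_id).matrix_trace
  exact hc.comp_continuousOn h

/-- A minimax principle for the variational formula of the measured relative entropy. -/
theorem exists_forall_posDef_le {ρ : Matrix m m ℂ} (hρ : ρ.PosSemidef) {K : Set (Matrix m m ℂ)}
    (hK : IsCompact K) (hKc : Convex ℝ K) {c : ℝ}
    (h : ∀ ω : Matrix m m ℂ, ω.PosDef → ∃ τ ∈ K,
      (ρ * cfc Real.log ω).trace.re + 1 - (ω * τ).trace.re ≤ c) :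
    ∃ τ ∈ K, ∀ ω : Matrix m m ℂ, ω.PosDef →
      (ρ * cfc Real.log ω).trace.re + 1 - (ω * τ).trace.re ≤ c := by
  by_contra! hcon
  set f : Matrix m m ℂ → Matrix m m ℂ → ℝ := fun τ ω =>
    (ρ * cfc Real.log ω).trace.re + 1 - (ω * τ).trace.re with hf
  have hne : K.Nonempty := let ⟨τ, hτ, _⟩ := h 1 PosDef.one; ⟨τ, hτ⟩
  have hc1 : ∀ ω : Matrix m m ℂ, Continuous fun τ => f τ ω := fun ω =>
    continuous_const.sub
      (Complex.continuous_re.comp (continuous_const.mul continuous_id).matrix_trace)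
  have hc2 : ∀ τ : Matrix m m ℂ, ContinuousOn (f τ) {ω : Matrix m m ℂ | ω.PosDef} := fun τ =>
    ((continuousOn_re_trace_mul_log ρ).add continuousOn_const).sub
      (Complex.continuous_re.comp (continuous_id.mul continuous_const).matrix_trace).continuousOn
  have hconv : ∀ ω : Matrix m m ℂ, ConvexOn ℝ K fun τ => f τ ω := by
    refine fun ω => ⟨hKc, fun x _ y _ a b _ _ hab => le_of_eq ?_⟩
    simp only [hf, Matrix.mul_add, Matrix.mul_smul, trace_add, trace_smul, Complex.add_re,
      Complex.real_smul, Complex.re_ofReal_mul, smul_eq_mul]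
    linear_combination -((ρ * cfc Real.log ω).trace.re + 1) * hab
  have hconc : ∀ τ : Matrix m m ℂ, ConcaveOn ℝ {ω : Matrix m m ℂ | ω.PosDef} (f τ) := by
    intro τ
    refine ((concaveOn_re_trace_mul_log hρ).add_const 1).sub ⟨convex_setOf_posDef,
      fun x _ y _ a b _ _ hab => le_of_eq ?_⟩
    simp only [Matrix.add_mul, Matrix.smul_mul, trace_add, trace_smul, Complex.add_re,
      Complex.real_smul, Complex.re_ofReal_mul, smul_eq_mul]
  -- If every `τ` is beaten by some `ω`, compactness makes finitely many `ω` suffice. Sion's theorem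
  -- then yields one `ω` that beats all of `K`, contradicting `h`.
  obtain ⟨s, hsK⟩ := hK.elim_finite_subcover
    (fun ω : {ω : Matrix m m ℂ // ω.PosDef} => {τ | c < f τ ω})
    (fun ω => isOpen_lt continuous_const (hc1 ω)) fun τ hτ => by
      obtain ⟨ω, hω, hlt⟩ := hcon τ hτ
      exact Set.mem_iUnion.2 ⟨⟨ω, hω⟩, hlt⟩
  obtain ⟨ω, hω, hlt⟩ := Sion.exists_lt_iInf_of_lt_iInf_of_finite (f := f) (t := c)
    (Y := {ω : Matrix m m ℂ | ω.PosDef}) hne hK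
    (fun ω _ => (hc1 ω).lowerSemicontinuous.lowerSemicontinuousOn _)
    (fun ω _ => (hconv ω).quasiconvexOn) convex_setOf_posDef
    (fun τ _ => (hc2 τ).upperSemicontinuousOn) (fun τ _ => (hconc τ).quasiconcaveOn) hKc
    (s := (fun ω : {ω : Matrix m m ℂ // ω.PosDef} => (ω : Matrix m m ℂ)) '' s)
    (s.finite_toSet.image _) (by rintro _ ⟨ω, _, rfl⟩; exact ω.2) (fun τ hτ => by
      obtain ⟨ω, hω, hlt⟩ := Set.mem_iUnion₂.1 (hsK hτ)
      exact ⟨ω, ⟨ω, hω, rfl⟩, hlt⟩)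
  obtain ⟨τ, hτ, hle⟩ := h ω hω
  exact absurd (hlt τ hτ) (not_lt.2 hle)

end Minimax

/-! ### One recovery map for all test operators. -/

section Recovery

open scoped ComplexOrder

variable {A B C : Type*} [Fintype A] [DecidableEq A] [Fintype B] [DecidableEq B]
  [Fintype C] [DecidableEq C]

theorem continuous_phaseUnitary {m : Type*} [Fintype m] [DecidableEq m] (M : Matrix m m ℂ) :
    Continuous fun ϑ : ℝ → ℝ => phaseUnitary M ϑ := by
  unfold phaseUnitary
  fun_prop

theorem continuous_idTensor_rotatedPetz (σ : Matrix (B × C) (B × C) ℂ)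
    (M : Matrix (A × B) (A × B) ℂ) :
    Continuous fun p : (ℝ → ℝ) × (ℝ → ℝ) =>
      idTensor A (rotatedPetz σ (traceRight B C) p.1 p.2) M := by
  simp_rw [idTensor_rotatedPetz]
  refine continuous_iff_continuousAt.2 fun p => tendsto_sandwich (ContinuousAt.tendsto ?_)
    (ContinuousAt.tendsto ?_)
  · exact (((continuous_phaseUnitary _).comp continuous_snd).mul continuous_const).continuousAt
  · have h : Continuous fun p : (ℝ → ℝ) × (ℝ → ℝ) =>
        ampLeft A (invSqrt (traceRight B C σ) * phaseUnitary (traceRight B C σ) p.1) :=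
      continuous_ampLeft.comp
        (continuous_const.mul ((continuous_phaseUnitary _).comp continuous_fst))
    exact ((h.mul continuous_const).mul h.matrix_conjTranspose).continuousAt

theorem posSemidef_ampAB {M : Matrix (A × B) (A × B) ℂ} (hM : M.PosSemidef) :
    (ampAB A B C M).PosSemidef := by
  have h := posSemidef_self_mul_conjTranspose (ampAB A B C (cfc Real.sqrt M))
  rwa [ampAB_conjTranspose, (isHermitian_cfc _ _).eq, ← map_mul, cfc_sqrt_mul_self hM] at h

theorem posSemidef_idTensor_rotatedPetz (σ : Matrix (B × C) (B × C) ℂ) (φ ϑ : ℝ → ℝ)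
    {M : Matrix (A × B) (A × B) ℂ} (hM : M.PosSemidef) :
    (idTensor A (rotatedPetz σ (traceRight B C) φ ϑ) M).PosSemidef := by
  rw [idTensor_rotatedPetz]
  exact (posSemidef_ampAB (hM.mul_mul_conjTranspose_same _)).mul_mul_conjTranspose_same _

/-- Evaluation of `id_A ⊗ R` at a fixed operator, as a function of `R`. -/
def evalIdTensor {m n : Type*} [Fintype m] [DecidableEq m] [Fintype n] [DecidableEq n]
    (M : Matrix (A × m) (A × m) ℂ) :
    (Matrix m m ℂ →ₗ[ℂ] Matrix n n ℂ) →ₗ[ℝ] Matrix (A × n) (A × n) ℂ where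
  toFun R := idTensor A R M
  map_add' _ _ := rfl
  map_smul' _ _ := rfl

theorem convex_setOf_posSemidef {m : Type*} [Fintype m] [DecidableEq m] :
    Convex ℝ {M : Matrix m m ℂ | M.PosSemidef} := by
  intro x hx y hy a b ha hb _
  exact (PosSemidef.smul hx ha).add (PosSemidef.smul hy hb)

/-- A single recovery map in the hull satisfies the tested bound for all positive definite `ω`. -/
theorem exists_recovery {ρ : Matrix (A × B × C) (A × B × C) ℂ} (hρ : IsDensity ρ) :
    ∃ R ∈ rotatedPetzHull (traceLeft A (B × C) ρ) (traceRight B C),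
      (idTensor A R (idTensor A (traceRight B C) ρ)).PosSemidef ∧
      ∀ ω : Matrix (A × B × C) (A × B × C) ℂ, ω.PosDef →
        (ρ * cfc Real.log ω).trace.re + 1 -
          (ω * idTensor A R (idTensor A (traceRight B C) ρ)).trace.re ≤ condMutualInfo ρ := by
  set σ := traceLeft A (B × C) ρ with hσ
  set μ := idTensor A (traceRight B C) ρ with hμ
  have hμp : μ.PosSemidef := posSemidef_idTensor_traceRight hρ.1
  set T : Set (Matrix B B ℂ →ₗ[ℂ] Matrix (B × C) (B × C) ℂ) :=
    {T | ∃ φ ϑ : ℝ → ℝ, (∀ x, φ x ∈ Set.Icc 0 (2 * Real.pi)) ∧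
      (∀ x, ϑ x ∈ Set.Icc 0 (2 * Real.pi)) ∧ T = rotatedPetz σ (traceRight B C) φ ϑ} with hT
  have himg : evalIdTensor μ '' T = (fun p : (ℝ → ℝ) × (ℝ → ℝ) =>
      idTensor A (rotatedPetz σ (traceRight B C) p.1 p.2) μ) ''
      ((Set.pi Set.univ fun _ : ℝ => Set.Icc (0 : ℝ) (2 * Real.pi)) ×ˢ
        (Set.pi Set.univ fun _ : ℝ => Set.Icc (0 : ℝ) (2 * Real.pi))) := by
    apply Set.Subset.antisymm
    · rintro _ ⟨_, ⟨φ, ϑ, hφ, hϑ, rfl⟩, rfl⟩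
      exact ⟨(φ, ϑ), ⟨fun x _ => hφ x, fun x _ => hϑ x⟩, rfl⟩
    · rintro _ ⟨⟨φ, ϑ⟩, ⟨hφ, hϑ⟩, rfl⟩
      exact ⟨_, ⟨φ, ϑ, fun x => hφ x trivial, fun x => hϑ x trivial, rfl⟩, rfl⟩
  have hcomp : IsCompact (evalIdTensor μ '' T) := by
    rw [himg]
    exact ((isCompact_univ_pi fun _ => isCompact_Icc).prod
      (isCompact_univ_pi fun _ => isCompact_Icc)).image (continuous_idTensor_rotatedPetz σ μ)
  obtain ⟨τ, hτ, hle⟩ := exists_forall_posDef_le hρ.1 (c := condMutualInfo ρ)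
    (isCompact_convexHull_of_finiteDimensional hcomp) (convex_convexHull ℝ _) (fun ω hω => by
      obtain ⟨φ, ϑ, hφ, hϑ, h⟩ := exists_rotatedPetz_le hρ hω
      exact ⟨_, subset_convexHull ℝ _ ⟨_, ⟨φ, ϑ, hφ, hϑ, rfl⟩, rfl⟩, h⟩)
  have hpos : τ.PosSemidef := by
    refine convexHull_min (t := {M : Matrix (A × B × C) (A × B × C) ℂ | M.PosSemidef})
      ?_ convex_setOf_posSemidef hτ
    rintro _ ⟨_, ⟨φ, ϑ, _, _, rfl⟩, rfl⟩
    exact posSemidef_idTensor_rotatedPetz σ φ ϑ hμp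
  -- Minimax runs over recovered states; since evaluation is linear, the optimal state comes from a
  -- map in the hull.
  rw [← LinearMap.image_convexHull] at hτ
  obtain ⟨R, hR, rfl⟩ := hτ
  exact ⟨R, hR, hpos, hle⟩

end Recovery

/-! ### From test operators to projective measurements. -/

section Measurement

open scoped ComplexOrder

variable {m : Type*} [Fintype m] [DecidableEq m]

/-- Algebra homomorphisms commute with polynomials, and `f` agrees with an interpolating polynomial
on the finite set of spectral points and values of `c`. -/
theorem cfc_algHom {ι : Type*} [Fintype ι] (Φ : (ι → ℝ) →ₐ[ℝ] Matrix m m ℂ)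
    (hΦ : ∀ c, (Φ c).IsHermitian) (f : ℝ → ℝ) (c : ι → ℝ) :
    cfc f (Φ c) = Φ (fun x => f (c x)) := by
  classical
  set S : Finset ℝ := (Matrix.finite_real_spectrum (A := Φ c)).toFinset ∪ Finset.univ.image c
  set p := Lagrange.interpolate S id f with hp
  have hev : ∀ x ∈ S, p.eval x = f x := fun x hx =>
    Lagrange.eval_interpolate_at_node f (Set.injOn_id _) hx
  have h1 : cfc f (Φ c) = cfc (fun x => p.eval x) (Φ c) :=
    cfc_congr fun x hx => (hev x (Finset.mem_union_left _ ((Set.Finite.mem_toFinset _).2 hx))).symm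
  rw [h1, cfc_polynomial p (Φ c) (hΦ c).isSelfAdjoint, Polynomial.aeval_algHom_apply]
  congr 1
  ext x
  have h2 := Polynomial.aeval_algHom_apply (Pi.evalAlgHom ℝ (fun _ : ι => ℝ) x) c p
  rw [Pi.evalAlgHom_apply, Pi.evalAlgHom_apply] at h2
  rw [← h2, Polynomial.coe_aeval_eq_eval]
  exact hev _ (Finset.mem_union_right _ (Finset.mem_image_of_mem _ (Finset.mem_univ _)))

/-- The squared Hilbert–Schmidt norms of `M z * M y`, summed over `z`, give `tr (M y)`, which the
term `z = y` already exhausts. -/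
theorem IsProjectiveMeasurement.mul_eq_zero {r : ℕ} {M : Fin r → Matrix m m ℂ}
    (hM : IsProjectiveMeasurement M) {x y : Fin r} (hxy : x ≠ y) : M x * M y = 0 := by
  have hsum : ∑ z, ((M z * M y)ᴴ * (M z * M y)).trace.re = (M y).trace.re := by
    have e : ∀ z, (M z * M y)ᴴ * (M z * M y) = M y * M z * M y := fun z => by
      rw [conjTranspose_mul, (hM.1 z).1.eq, (hM.1 y).1.eq, ← Matrix.mul_assoc,
        Matrix.mul_assoc (M y) (M z) (M z), (hM.1 z).2]
    simp_rw [e, ← Complex.re_sum, ← trace_sum, ← Finset.sum_mul, ← Finset.mul_sum, hM.2,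
      Matrix.mul_one, (hM.1 y).2]
  rw [← Finset.add_sum_erase _ _ (Finset.mem_univ y)] at hsum
  have hy : ((M y * M y)ᴴ * (M y * M y)).trace.re = (M y).trace.re := by
    rw [(hM.1 y).2, (hM.1 y).1.eq, (hM.1 y).2]
  rw [hy, add_eq_left, Finset.sum_eq_zero_iff_of_nonneg
    fun z _ => re_trace_conjTranspose_mul_self_nonneg _] at hsum
  have h0 := hsum x (Finset.mem_erase.2 ⟨hxy, Finset.mem_univ _⟩)
  have hps := posSemidef_conjTranspose_mul_self (M x * M y)
  refine trace_conjTranspose_mul_self_eq_zero_iff.1 (Complex.ext h0 ?_)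
  exact (Complex.nonneg_iff.1 hps.trace_nonneg).2.symm

/-- The algebra homomorphism `c ↦ ∑ x, c x • M x` of a projective measurement. -/
def IsProjectiveMeasurement.algHom {r : ℕ} {M : Fin r → Matrix m m ℂ}
    (hM : IsProjectiveMeasurement M) : (Fin r → ℝ) →ₐ[ℝ] Matrix m m ℂ :=
  AlgHom.ofLinearMap (Fintype.linearCombination ℝ M)
    (by simp [Fintype.linearCombination_apply, hM.2])
    (fun c d => by
      simp only [Fintype.linearCombination_apply, Finset.sum_mul, Finset.mul_sum]
      refine Finset.sum_congr rfl fun x _ => ?_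
      rw [Finset.sum_eq_single x]
      · rw [Matrix.smul_mul, Matrix.mul_smul, (hM.1 x).2, smul_smul, Pi.mul_apply]
      · intro y _ hy
        rw [Matrix.smul_mul, Matrix.mul_smul, hM.mul_eq_zero hy, smul_zero, smul_zero]
      · simp)

theorem IsProjectiveMeasurement.algHom_apply {r : ℕ} {M : Fin r → Matrix m m ℂ}
    (hM : IsProjectiveMeasurement M) (c : Fin r → ℝ) : hM.algHom c = ∑ x, c x • M x := rfl

theorem IsProjectiveMeasurement.posSemidef {r : ℕ} {M : Fin r → Matrix m m ℂ}
    (hM : IsProjectiveMeasurement M) (x : Fin r) : (M x).PosSemidef := by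
  have h := posSemidef_conjTranspose_mul_self (M x)
  rwa [(hM.1 x).1.eq, (hM.1 x).2] at h

theorem IsProjectiveMeasurement.isHermitian_algHom {r : ℕ} {M : Fin r → Matrix m m ℂ}
    (hM : IsProjectiveMeasurement M) (c : Fin r → ℝ) : (hM.algHom c).IsHermitian := by
  rw [hM.algHom_apply, Matrix.IsHermitian, conjTranspose_sum]
  refine Finset.sum_congr rfl fun x _ => ?_
  rw [conjTranspose_smul, (hM.1 x).1.eq, star_trivial]

theorem IsProjectiveMeasurement.posDef_algHom {r : ℕ} {M : Fin r → Matrix m m ℂ}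
    (hM : IsProjectiveMeasurement M) {c : Fin r → ℝ} (hc : ∀ x, 0 < c x) :
    (hM.algHom c).PosDef := by
  have hps : (hM.algHom c).PosSemidef := by
    rw [hM.algHom_apply]
    exact posSemidef_sum _ fun x _ => PosSemidef.smul (hM.posSemidef x) (hc x).le
  refine hps.posDef_iff_isUnit.2 ?_
  have hmul : hM.algHom c * hM.algHom c⁻¹ = 1 := by
    rw [← map_mul, ← map_one hM.algHom]
    congr 1
    ext x
    simp [(hc x).ne']
  exact IsUnit.of_mul_eq_one _ hmul

/-- Real diagonal matrices as an algebra homomorphism. -/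
def realDiagonal (ι : Type*) [Fintype ι] [DecidableEq ι] : (ι → ℝ) →ₐ[ℝ] Matrix ι ι ℂ :=
  (diagonalAlgHom ℝ).comp (Complex.ofRealAm.compLeft ι)

theorem realDiagonal_apply {ι : Type*} [Fintype ι] [DecidableEq ι] (p : ι → ℝ) :
    realDiagonal ι p = diagonal fun x => (p x : ℂ) := rfl

theorem isHermitian_realDiagonal {ι : Type*} [Fintype ι] [DecidableEq ι] (p : ι → ℝ) :
    (realDiagonal ι p).IsHermitian := by
  rw [realDiagonal_apply, Matrix.IsHermitian, diagonal_conjTranspose]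
  congr 1
  ext x
  simp

theorem range_diagonal_le_iff {ι : Type*} [Fintype ι] [DecidableEq ι] (v w : ι → ℂ) :
    LinearMap.range (diagonal v).mulVecLin ≤ LinearMap.range (diagonal w).mulVecLin ↔
      ∀ x, w x = 0 → v x = 0 := by
  constructor
  · intro h x hx
    obtain ⟨z, hz⟩ := h ⟨Pi.single x 1, rfl⟩
    have := congrFun hz x
    simpa [mulVec_diagonal, hx] using this.symm
  · rintro h _ ⟨y, rfl⟩
    refine ⟨fun x => v x * y x / w x, ?_⟩
    ext x
    simp only [mulVecLin_apply, mulVec_diagonal]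
    by_cases hx : w x = 0
    · simp [hx, h x hx]
    · field_simp

theorem relEntropy_realDiagonal {ι : Type*} [Fintype ι] [DecidableEq ι] {p q : ι → ℝ}
    (h : ∀ x, q x = 0 → p x = 0) :
    relEntropy (realDiagonal ι p) (realDiagonal ι q) =
      ((∑ x, p x * (Real.log (p x) - Real.log (q x)) : ℝ) : EReal) := by
  rw [relEntropy, if_pos]
  · rw [cfc_algHom _ isHermitian_realDiagonal, cfc_algHom _ isHermitian_realDiagonal, ← map_sub,
      ← map_mul, realDiagonal_apply, trace_diagonal, Complex.re_sum]
    rfl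
  · rw [realDiagonal_apply, realDiagonal_apply, range_diagonal_le_iff]
    intro x hx
    exact_mod_cast h x (by exact_mod_cast hx)

theorem relEntropy_realDiagonal_eq_top {ι : Type*} [Fintype ι] [DecidableEq ι] {p q : ι → ℝ}
    {x : ι} (hq : q x = 0) (hp : p x ≠ 0) :
    relEntropy (realDiagonal ι p) (realDiagonal ι q) = ⊤ := by
  rw [relEntropy, if_neg]
  rw [realDiagonal_apply, realDiagonal_apply, range_diagonal_le_iff]
  intro h
  exact hp (by exact_mod_cast h x (by simp [hq]))

theorem trace_mul_nonneg {X Y : Matrix m m ℂ} (hX : X.PosSemidef) (hY : Y.PosSemidef) :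
    0 ≤ (X * Y).trace := by
  have h := hY.mul_mul_conjTranspose_same (cfc Real.sqrt X)
  rw [← cfc_sqrt_mul_self hX, Matrix.mul_assoc, trace_mul_comm]
  rw [(isHermitian_cfc _ _).eq] at h
  exact h.trace_nonneg

theorem measure_eq_realDiagonal {r : ℕ} {M : Fin r → Matrix m m ℂ}
    (hM : IsProjectiveMeasurement M) {ρ : Matrix m m ℂ} (hρ : ρ.PosSemidef) :
    measure M ρ = realDiagonal (Fin r) fun x => (ρ * M x).trace.re := by
  rw [measure, realDiagonal_apply]
  congr 1
  ext x
  exact Complex.eq_re_of_ofReal_le (r := 0) (by simpa using trace_mul_nonneg hρ (hM.posSemidef x))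

theorem sum_re_trace_mul {r : ℕ} {M : Fin r → Matrix m m ℂ} (hM : IsProjectiveMeasurement M)
    (ρ : Matrix m m ℂ) : ∑ x, (ρ * M x).trace.re = ρ.trace.re := by
  rw [← Complex.re_sum, ← trace_sum, ← Finset.mul_sum, hM.2, Matrix.mul_one]

theorem re_trace_mul_algHom {r : ℕ} {M : Fin r → Matrix m m ℂ} (hM : IsProjectiveMeasurement M)
    (ρ : Matrix m m ℂ) (c : Fin r → ℝ) :
    (ρ * hM.algHom c).trace.re = ∑ x, (ρ * M x).trace.re * c x := by
  rw [hM.algHom_apply, Finset.mul_sum, trace_sum, Complex.re_sum]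
  refine Finset.sum_congr rfl fun x _ => ?_
  rw [Matrix.mul_smul, trace_smul, Complex.real_smul, Complex.re_ofReal_mul, mul_comm]

/-- The classical variational formula for the relative entropy. -/
theorem relEntropy_realDiagonal_le {ι : Type*} [Fintype ι] [DecidableEq ι] {p q : ι → ℝ}
    (hp : ∀ x, 0 ≤ p x) (hq : ∀ x, 0 ≤ q x) (hp1 : ∑ x, p x = 1) {c : ℝ}
    (h : ∀ s : ι → ℝ, ∑ x, p x * s x + 1 - ∑ x, q x * Real.exp (s x) ≤ c) :
    relEntropy (realDiagonal ι p) (realDiagonal ι q) ≤ c := by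
  have hQ : 0 ≤ ∑ x, q x := Finset.sum_nonneg fun x _ => hq x
  have hsupp : ∀ x, q x = 0 → p x = 0 := by
    intro x hx
    by_contra hpx
    -- A spike at `x` costs nothing when `q x = 0`; this height makes the tested value `c + 1`.
    set t := (c + ∑ y, q y) / p x with ht
    have h1 := h (Pi.single x t)
    have e1 : ∑ y, p y * (Pi.single x t : ι → ℝ) y = c + ∑ y, q y := by
      rw [Finset.sum_eq_single x]
      · rw [Pi.single_eq_same, ht, mul_div_cancel₀ _ hpx]
      · intro y _ hy
        rw [Pi.single_eq_of_ne hy, mul_zero]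
      · simp
    have e2 : ∑ y, q y * Real.exp ((Pi.single x t : ι → ℝ) y) = ∑ y, q y := by
      refine Finset.sum_congr rfl fun y _ => ?_
      by_cases hy : y = x
      · rw [hy, hx, zero_mul]
      · rw [Pi.single_eq_of_ne hy, Real.exp_zero, mul_one]
    linarith
  rw [relEntropy_realDiagonal hsupp, EReal.coe_le_coe_iff]
  refine le_of_forall_pos_le_add fun δ hδ => ?_
  have hη : 0 < δ / (∑ x, q x + 1) := by positivity
  set t := Real.log (δ / (∑ x, q x + 1)) with ht
  -- The optimal test function is `log (p / q)`. Where `p = 0` it would be `-∞`, and the finite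
  -- value `t` costs at most `δ` in total.
  have h1 := h fun x => if p x = 0 then t else Real.log (p x) - Real.log (q x)
  have e1 : ∑ x, p x * (if p x = 0 then t else Real.log (p x) - Real.log (q x)) =
      ∑ x, p x * (Real.log (p x) - Real.log (q x)) := by
    refine Finset.sum_congr rfl fun x _ => ?_
    split_ifs with hx
    · rw [hx, zero_mul, zero_mul]
    · rfl
  have e2 : ∑ x, q x * Real.exp (if p x = 0 then t else Real.log (p x) - Real.log (q x)) ≤
      ∑ x, (p x + q x * (δ / (∑ x, q x + 1))) := by
    refine Finset.sum_le_sum fun x _ => ?_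
    split_ifs with hx
    · rw [ht, Real.exp_log hη, hx, zero_add]
    · have hpx : 0 < p x := lt_of_le_of_ne (hp x) (Ne.symm hx)
      have hqx : 0 < q x := lt_of_le_of_ne (hq x) fun h0 => hx (hsupp x h0.symm)
      rw [Real.exp_sub, Real.exp_log hpx, Real.exp_log hqx, mul_div_cancel₀ _ hqx.ne']
      have := mul_nonneg (hq x) hη.le
      linarith
  rw [Finset.sum_add_distrib, hp1, ← Finset.sum_mul] at e2
  have e3 : (∑ x, q x) * (δ / (∑ x, q x + 1)) ≤ δ := by
    rw [mul_div_assoc', div_le_iff₀ (by positivity)]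
    nlinarith
  rw [e1] at h1
  linarith

/-- Testing with `ω = ∑ exp (s x) M_x`, whose logarithm is `∑ s x M_x`, gives the hypothesis of the
classical variational formula. -/
theorem measuredRelEntropy_le {ρ τ : Matrix m m ℂ} (hρ : IsDensity ρ) (hτ : τ.PosSemidef) {c : ℝ}
    (h : ∀ ω : Matrix m m ℂ, ω.PosDef →
      (ρ * cfc Real.log ω).trace.re + 1 - (ω * τ).trace.re ≤ c) :
    measuredRelEntropy ρ τ ≤ c := by
  refine iSup_le fun r => iSup_le fun M => iSup_le fun hM => ?_
  rw [measure_eq_realDiagonal hM hρ.1, measure_eq_realDiagonal hM hτ]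
  refine relEntropy_realDiagonal_le (fun x => re_trace_mul_nonneg hρ.1 (hM.posSemidef x))
    (fun x => re_trace_mul_nonneg hτ (hM.posSemidef x)) ?_ fun s => ?_
  · rw [sum_re_trace_mul hM, hρ.2, Complex.one_re]
  · have h1 := h _ (hM.posDef_algHom (c := fun x => Real.exp (s x)) fun x => Real.exp_pos _)
    rw [cfc_algHom _ hM.isHermitian_algHom, re_trace_mul_algHom, trace_mul_comm _ τ,
      re_trace_mul_algHom] at h1
    simpa using h1

end Measurement

/-! ### The fidelity bound through an optimal measurement. -/

section Fidelity

open scoped ComplexOrder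

variable {m : Type*} [Fintype m] [DecidableEq m]

/-- The measurement in the eigenbasis of a Hermitian matrix. -/
theorem exists_eigenMeasurement {Γ : Matrix m m ℂ} (hΓ : Γ.PosSemidef) :
    ∃ (r : ℕ) (M : Fin r → Matrix m m ℂ) (γ : Fin r → ℝ), IsProjectiveMeasurement M ∧
      (∀ x, 0 ≤ γ x) ∧ (∀ x, Γ * M x = (γ x : ℂ) • M x) ∧ ∀ x, M x * Γ = (γ x : ℂ) • M x := by
  set U := (hΓ.1.eigenvectorUnitary : Matrix m m ℂ) with hU
  have hUU : star U * U = 1 := star_eigenvectorUnitary_mul_self hΓ.1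
  have hUU' : U * star U = 1 := eigenvectorUnitary_mul_star_self hΓ.1
  let e := (Fintype.equivFin m).symm
  have hΓU : Γ = U * diagonal (fun i => (hΓ.1.eigenvalues i : ℂ)) * star U :=
    eq_spectralMap_id hΓ.1
  have hmul : ∀ v w : m → ℂ, (U * diagonal v * star U) * (U * diagonal w * star U) =
      U * diagonal (fun i => v i * w i) * star U := fun v w => by
    calc _ = U * diagonal v * (star U * U) * diagonal w * star U := by
          simp only [Matrix.mul_assoc]
      _ = _ := by rw [hUU, Matrix.mul_one, Matrix.mul_assoc U, diagonal_mul_diagonal]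
  refine ⟨Fintype.card m, fun x => U * diagonal (Pi.single (e x) 1) * star U,
    fun x => hΓ.1.eigenvalues (e x), ⟨fun x => ⟨?_, ?_⟩, ?_⟩, fun x => hΓ.eigenvalues_nonneg _,
    fun x => ?_, fun x => ?_⟩
  · rw [Matrix.IsHermitian, star_eq_conjTranspose, conjTranspose_mul, conjTranspose_mul,
      conjTranspose_conjTranspose, diagonal_conjTranspose, ← Matrix.mul_assoc]
    congr 3
    ext i
    by_cases h : i = e x
    · subst h; simp
    · simp [Pi.single_eq_of_ne h]
  · rw [hmul]
    congr 3
    ext i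
    by_cases h : i = e x
    · subst h; simp
    · simp [Pi.single_eq_of_ne h]
  · rw [← Finset.sum_mul, ← Finset.mul_sum]
    have h1 : ∑ x, diagonal (Pi.single (e x) (1 : ℂ)) = (1 : Matrix m m ℂ) := by
      rw [Equiv.sum_comp e (fun i => diagonal (Pi.single i (1 : ℂ)))]
      ext i j
      rw [Matrix.sum_apply, one_apply]
      simp only [diagonal_apply]
      split_ifs with h
      · subst h
        simp [Pi.single_apply]
      · simp
    rw [h1, Matrix.mul_one, hUU']
  · conv_lhs => rw [hΓU]
    rw [hmul, ← Matrix.smul_mul, ← Matrix.mul_smul, ← diagonal_smul]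
    congr 3
    ext i
    by_cases h : i = e x
    · subst h; simp
    · simp [Pi.single_eq_of_ne h]
  · conv_lhs => rw [hΓU]
    rw [hmul, ← Matrix.smul_mul, ← Matrix.mul_smul, ← diagonal_smul]
    congr 3
    ext i
    by_cases h : i = e x
    · subst h; simp
    · simp [Pi.single_eq_of_ne h]

/-- The relative entropy of distributions with likelihood ratio `γ²` is at least `-2 log ∑ γ q`. -/
theorem neg_two_mul_log_le_sum {ι : Type*} [Fintype ι] {γ p q : ι → ℝ} (hγ : ∀ x, 0 ≤ γ x)
    (hq : ∀ x, 0 ≤ q x) (hp : ∀ x, p x = γ x ^ 2 * q x) (hp1 : ∑ x, p x = 1) :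
    0 < ∑ x, γ x * q x ∧
      -(2 * Real.log (∑ x, γ x * q x)) ≤ ∑ x, p x * (Real.log (p x) - Real.log (q x)) := by
  have hF0 : 0 ≤ ∑ x, γ x * q x := Finset.sum_nonneg fun x _ => mul_nonneg (hγ x) (hq x)
  have hFpos : 0 < ∑ x, γ x * q x := by
    refine lt_of_le_of_ne hF0 fun h => ?_
    rw [eq_comm, Finset.sum_eq_zero_iff_of_nonneg fun x _ => mul_nonneg (hγ x) (hq x)] at h
    have : ∑ x, p x = 0 := Finset.sum_eq_zero fun x hx => by
      rw [hp, pow_two, mul_assoc, h x hx, mul_zero]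
    rw [hp1] at this
    exact one_ne_zero this
  refine ⟨hFpos, ?_⟩
  set F := ∑ x, γ x * q x with hF
  -- Jensen's inequality in tangent-line form, from `1 - 1 / u ≤ log u` at `u = γ x * F`; the first
  -- term sums to zero.
  have hterm : ∀ x, 2 * (p x - γ x * q x / F) - 2 * Real.log F * p x ≤
      p x * (Real.log (p x) - Real.log (q x)) := by
    intro x
    rcases (hγ x).eq_or_lt with h | h
    · rw [hp, ← h]; simp
    rcases (hq x).eq_or_lt with h' | h'
    · rw [hp, ← h']; simp
    have h1 : Real.log (p x) - Real.log (q x) = 2 * Real.log (γ x) := by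
      rw [hp, Real.log_mul (by positivity) h'.ne', Real.log_pow]
      push_cast; ring
    have h2 := Real.one_sub_inv_le_log_of_pos (mul_pos h hFpos)
    rw [Real.log_mul h.ne' hFpos.ne'] at h2
    have hpx : 0 < p x := by rw [hp]; positivity
    have h3 := mul_le_mul_of_nonneg_left h2 hpx.le
    have h4 : p x * (γ x * F)⁻¹ = γ x * q x / F := by
      rw [hp]; field_simp
    rw [h1]
    rw [mul_sub, h4] at h3
    nlinarith
  have := Finset.sum_le_sum fun x (_ : x ∈ Finset.univ) => hterm x
  rw [Finset.sum_sub_distrib, ← Finset.mul_sum, ← Finset.mul_sum, Finset.sum_sub_distrib,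
    ← Finset.sum_div, hp1, ← hF, div_self hFpos.ne'] at this
  linarith

theorem isProjectiveMeasurement_pair {P : Matrix m m ℂ} (hP : P.IsHermitian) (hPP : P * P = P) :
    IsProjectiveMeasurement ![P, 1 - P] := by
  refine ⟨fun x => ?_, by simp⟩
  fin_cases x
  · exact ⟨hP, hPP⟩
  · refine ⟨isHermitian_one.sub hP, ?_⟩
    change (1 - P) * (1 - P) = 1 - P
    rw [Matrix.sub_mul, Matrix.mul_sub, Matrix.mul_sub, hPP]
    simp

theorem mul_eq_zero_of_trace_eq_zero {ρ Z : Matrix m m ℂ} (hρ : ρ.PosSemidef)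
    (hZ : Z.IsHermitian) (h : (ρ * (Z * Z)).trace = 0) : ρ * Z = 0 := by
  set R := cfc Real.sqrt ρ
  have hR : Rᴴ = R := isHermitian_cfc _ _
  have hRR : R * R = ρ := cfc_sqrt_mul_self hρ
  have h1 : ((R * Z)ᴴ * (R * Z)).trace = 0 := by
    rw [conjTranspose_mul, hR, hZ.eq, Matrix.mul_assoc, ← Matrix.mul_assoc R, hRR, trace_mul_comm,
      Matrix.mul_assoc, h]
  rw [← hRR, Matrix.mul_assoc, trace_conjTranspose_mul_self_eq_zero_iff.1 h1, Matrix.mul_zero]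

/-- The measured relative entropy dominates the negative logarithm of the squared fidelity. -/
theorem neg_two_mul_log_fidelity_le {ρ τ : Matrix m m ℂ} (hρ : IsDensity ρ) (hτ : τ.PosSemidef) :
    -(2 * ENNReal.log (ENNReal.ofReal (fidelity ρ τ))) ≤ measuredRelEntropy ρ τ := by
  set S := cfc Real.sqrt τ with hS
  set V := invSqrt τ with hV
  set P := cfc (fun x : ℝ => if x = 0 then 0 else 1) τ with hP
  have hSh : Sᴴ = S := isHermitian_cfc _ _
  have hVh : Vᴴ = V := isHermitian_cfc _ _
  have hPh : Pᴴ = P := isHermitian_cfc _ _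
  have hSS : S * S = τ := cfc_sqrt_mul_self hτ
  have key : ∀ f g h : ℝ → ℝ, (∀ x, 0 ≤ x → f x * g x = h x) → cfc f τ * cfc g τ = cfc h τ := by
    intro f g h hfg
    simp_rw [cfc_eq_spectralMap hτ.1]
    rw [spectralMap_mul]
    refine spectralMap_congr _ fun i => ?_
    exact_mod_cast hfg _ (hτ.eigenvalues_nonneg i)
  have hsq : ∀ x : ℝ, 0 ≤ x → x ≠ 0 → √x ≠ 0 := fun x hx hx0 =>
    (Real.sqrt_pos.2 (lt_of_le_of_ne hx hx0.symm)).ne'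
  have hPP : P * P = P := key _ _ _ fun x _ => by split_ifs <;> simp
  have hSP : S * P = S := key _ _ _ fun x _ => by split_ifs with h <;> simp [h]
  have hSV : S * V = P := key _ _ _ fun x hx => by
    split_ifs with h
    · simp [h]
    · exact mul_inv_cancel₀ (hsq x hx h)
  have hVS : V * S = P := key _ _ _ fun x hx => by
    split_ifs with h
    · simp [h]
    · exact inv_mul_cancel₀ (hsq x hx h)
  have hPS : P * S = S := by rw [← hSh, ← hPh, ← conjTranspose_mul, hSP]
  -- `P` is the support projection of `τ`, so this asks whether the support of `ρ` lies in that of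
  -- `τ`.
  by_cases hsupp : ρ * (1 - P) = 0
  · have hρP : ρ * P = ρ := by
      rw [Matrix.mul_sub, Matrix.mul_one, sub_eq_zero] at hsupp
      exact hsupp.symm
    have hPρ : P * ρ = ρ := by
      have := congrArg conjTranspose hρP
      rwa [conjTranspose_mul, hPh, hρ.1.1.eq] at this
    set N := S * ρ * S with hN
    have hNp : N.PosSemidef := by
      have := hρ.1.mul_mul_conjTranspose_same S
      rwa [hSh] at this
    set Q := cfc Real.sqrt N with hQ
    have hQp : Q.PosSemidef := cfc_sqrt_posSemidef hNp
    have hQQ : Q * Q = N := cfc_sqrt_mul_self hNp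
    have hQP : Q * P = Q := by
      have h0 : Q * (1 - P) = 0 := by
        refine trace_conjTranspose_mul_self_eq_zero_iff.1 ?_
        rw [conjTranspose_mul, hQp.1.eq, Matrix.mul_assoc, ← Matrix.mul_assoc Q, hQQ, hN,
          Matrix.mul_assoc _ S, Matrix.mul_sub S, hSP, Matrix.mul_one, sub_self, Matrix.mul_zero,
          Matrix.mul_zero, trace_zero]
      rw [Matrix.mul_sub, Matrix.mul_one, sub_eq_zero] at h0
      exact h0.symm
    have hVτV : V * τ * V = P := by
      rw [← hSS, ← Matrix.mul_assoc, hVS, Matrix.mul_assoc, hSV, hPP]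
    -- The Fuchs–Caves operator, which solves `Γ τ Γ = ρ` and has `tr Γτ` equal to the fidelity. On
    -- its eigenprojections the outcome probabilities of `ρ` are `γ ^ 2` times those of `τ`.
    set Γ := V * Q * V with hΓ
    have hΓp : Γ.PosSemidef := by
      have := hQp.mul_mul_conjTranspose_same V
      rwa [hVh] at this
    have hΓρ : Γ * τ * Γ = ρ := by
      calc Γ * τ * Γ = V * (Q * (V * τ * V) * Q) * V := by simp only [hΓ, Matrix.mul_assoc]
        _ = (V * S) * ρ * (S * V) := by
          rw [hVτV, hQP, hQQ, hN]; simp only [Matrix.mul_assoc]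
        _ = ρ := by rw [hVS, hSV, hPρ, hρP]
    have hF : fidelity ρ τ = (Γ * τ).trace.re := by
      have hR : cfc Real.sqrt ρ * cfc Real.sqrt ρ = ρ := cfc_sqrt_mul_self hρ.1
      have hN' : (cfc Real.sqrt ρ * S)ᴴ * (cfc Real.sqrt ρ * S) = N := by
        rw [conjTranspose_mul, hSh, (isHermitian_cfc _ _).eq, Matrix.mul_assoc,
          ← Matrix.mul_assoc _ _ S, hR, hN, Matrix.mul_assoc]
      rw [fidelity, traceNorm, ← hS, hN', ← hQ]
      congr 1
      calc Q.trace = (Q * (V * τ * V)).trace := by rw [hVτV, hQP]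
        _ = (V * (Q * V * τ)).trace := by rw [trace_mul_comm V]; simp only [Matrix.mul_assoc]
        _ = (Γ * τ).trace := by simp only [hΓ, Matrix.mul_assoc]
    obtain ⟨r, M, γ, hM, hγ, hΓM, hMΓ⟩ := exists_eigenMeasurement hΓp
    have hp : ∀ x, (ρ * M x).trace.re = γ x ^ 2 * (τ * M x).trace.re := by
      intro x
      have e : (ρ * M x).trace = ((γ x ^ 2 : ℝ) : ℂ) * (τ * M x).trace := by
        conv_lhs => rw [← hΓρ]
        rw [Matrix.mul_assoc, hΓM, Matrix.mul_smul, trace_smul, Matrix.mul_assoc, trace_mul_comm,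
          Matrix.mul_assoc, hMΓ, Matrix.mul_smul, trace_smul, smul_eq_mul, smul_eq_mul]
        push_cast; ring
      rw [e, Complex.re_ofReal_mul]
    have hFsum : fidelity ρ τ = ∑ x, γ x * (τ * M x).trace.re := by
      have e : ∀ x, γ x * (τ * M x).trace.re = ((τ * Γ) * M x).trace.re := fun x => by
        rw [Matrix.mul_assoc, hΓM, Matrix.mul_smul, trace_smul, smul_eq_mul, Complex.re_ofReal_mul]
      simp_rw [e]
      rw [sum_re_trace_mul hM, hF, trace_mul_comm]
    obtain ⟨hpos, hle⟩ := neg_two_mul_log_le_sum hγ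
      (fun x => re_trace_mul_nonneg hτ (hM.posSemidef x)) hp
      (by rw [sum_re_trace_mul hM, hρ.2, Complex.one_re])
    rw [← hFsum] at hpos hle
    have hD : relEntropy (measure M ρ) (measure M τ) ≤ measuredRelEntropy ρ τ :=
      le_iSup_of_le r (le_iSup_of_le M (le_iSup_of_le hM le_rfl))
    refine le_trans ?_ hD
    rw [measure_eq_realDiagonal hM hρ.1, measure_eq_realDiagonal hM hτ,
      relEntropy_realDiagonal (fun x hx => by rw [hp, hx, mul_zero]),
      ENNReal.log_ofReal_of_pos hpos]
    have h2 : (2 : EReal) = ((2 : ℝ) : EReal) := rfl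
    rw [h2, ← EReal.coe_mul, ← EReal.coe_neg]
    exact EReal.coe_le_coe_iff.2 hle
  · have hZ : (1 - P).IsHermitian := isHermitian_one.sub hPh
    -- Outcome `1 - P` has probability zero under `τ` but not under `ρ`, so the measured relative
    -- entropy is `⊤`.
    have hM := isProjectiveMeasurement_pair hPh hPP
    have hZZ : (1 - P) * (1 - P) = 1 - P := (hM.1 1).2
    have hp : (ρ * (1 - P)).trace.re ≠ 0 := by
      intro h0
      refine hsupp (mul_eq_zero_of_trace_eq_zero hρ.1 hZ ?_)
      rw [hZZ]
      refine Complex.ext h0 ?_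
      exact (Complex.nonneg_iff.1 (trace_mul_nonneg hρ.1 (hM.posSemidef 1))).2.symm
    have hq : (τ * (1 - P)).trace.re = 0 := by
      rw [← hSS, Matrix.mul_assoc, Matrix.mul_sub, hSP, Matrix.mul_one, sub_self, Matrix.mul_zero,
        trace_zero, Complex.zero_re]
    have hD : relEntropy (measure ![P, 1 - P] ρ) (measure ![P, 1 - P] τ) ≤ measuredRelEntropy ρ τ :=
      le_iSup_of_le 2 (le_iSup_of_le _ (le_iSup_of_le hM le_rfl))
    rw [measure_eq_realDiagonal hM hρ.1, measure_eq_realDiagonal hM hτ,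
      relEntropy_realDiagonal_eq_top (x := (1 : Fin 2)) hq hp] at hD
    exact le_top.trans hD

end Fidelity

end QuantumRecovery

end

open QuantumRecovery
theorem mainTheorem3 {A B C : Type*} [Fintype A] [DecidableEq A] [Fintype B] [DecidableEq B]
    [Fintype C] [DecidableEq C] (ρ : Matrix (A × B × C) (A × B × C) ℂ) (hρ : IsDensity ρ) :
    ∃ R ∈ rotatedPetzHull (traceLeft A (B × C) ρ) (traceRight B C),
      measuredRelEntropy ρ (idTensor A R (idTensor A (traceRight B C) ρ))
          ≤ (condMutualInfo ρ : EReal) ∧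
      -(2 * ENNReal.log (ENNReal.ofReal
            (fidelity ρ (idTensor A R (idTensor A (traceRight B C) ρ)))))
          ≤ measuredRelEntropy ρ (idTensor A R (idTensor A (traceRight B C) ρ)) := by
  obtain ⟨R, hR, hpos, hle⟩ := exists_recovery hρ
  exact ⟨R, hR, measuredRelEntropy_le hρ hpos hle, neg_two_mul_log_fidelity_le hρ hpos⟩
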